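/- For $n\ge 2$ let $\Delta_n$ be the probability simplex. For $(x,y)\in\Delta_n^2$ let $$\mathcal G(x,y)=\{(A,B)\in([-1,1]^{n\times n})^2:\ x^\top A y\le e_i^\top A y,\ \ x^\top B y\le x^\top B e_j\ \ \forall i,j\}$$ be the set of general-sum games (in losses) of which $(x,y)$ is an exact Nash equilibrium, and let $$\mathcal Z(x,y)=\{A\in[-1,1]^{n\times n}:\ x^\top A e_j\le x^\top A y\le e_i^\top A y\ \ \forall i,j\}$$ be the analogous set of zero-sum games. Put $\pi_{\min}(x,y)=\min\{\min_{i:x_i>0}x_i,\ \min_{j:y_j>0}y_j\}$ and, for $\pi_{\min}>0$, let $\mathcal C_n(\pi_{\min})=\{(x,y)\in\Delta_n^2:\pi_{\min}(x,y)\ge\pi_{\min}\}$ be the class of instances. A (possibly randomized) learning algorithm observes i.i.d. pairs $(X_t,Y_t)\sim x\times y$ for an unknown instance $(x,y)$, stops at a stopping time $\tau_\delta$, and then outputs a set $\hat{\mathcal G}$ of pairs of matrices (in the zero-sum problem, a set $\hat{\mathcal Z}$ of matrices). It is $(\epsilon,\delta)$-correct if for every $(x,y)\in\mathcal C_n(\pi_{\min})$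 the probability that it stops with an output satisfying $H(\mathcal G(x,y),\hat{\mathcal G})\ge\epsilon$ (respectively $H(\mathcal Z(x,y),\hat{\mathcal Z})\ge\epsilon$) is at most $\delta$, where $H$ is the Hausdorff distance for the entrywise $\ell_\infty$ distance. **Theorem.** There is a universal constant $c>0$ such that for all $n\ge2$, all $\epsilon\in(0,1/384)$, all $\delta\in(0,1/2]$ and all $\pi_{\min}>0$ with $\pi_{\min}\le\frac1n$ and $\pi_{\min}\le\frac12-2\epsilon$ (the last condition is automatic for $n\ge3$), the following holds, both for general-sum and for zero-sum games. 1. There is an instance $(x,y)\in\mathcal C_n(\pi_{\min})$ such that every $(\epsilon,\delta)$-correct algorithm satisfies $$\mathbb E_{x,y}[\tau_\delta]\ \ge\ c\left(\frac{\log(1/\delta)}{\log\frac1{1-\pi_{\min}}}+\frac{\log(1/\delta)}{\epsilon^2}\right).$$ 2. For every $(\epsilon,\delta)$-correct algorithm there is an instance $(x,y)\in\mathcal C_n(\pi_{\min})$ such that $$\mathbb E_{x,y}[\tau_\delta]\ \ge\ c\left(\frac{\log(1/\delta)}{\log\frac1{1-\pi_{\min}}}+\frac{n+\log(1/\delta)}{\epsilon^2}\right).$$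 -/

import Mathlib

open MeasureTheory
open scoped ENNReal

namespace InverseGame

/-- The probability simplex `Δ_n`: mixed strategies over `n` actions. -/
abbrev Strategy (n : ℕ) : Type := stdSimplex ℝ (Fin n)

/-- A strategy profile `(x, y)`; this is a problem instance. -/
abbrev Profile (n : ℕ) : Type := Strategy n × Strategy n

/-- Real `n × n` matrices. As an iterated function space it carries the entrywise `ℓ_∞` distance,
and pairs of matrices carry the maximum of the two distances. -/
abbrev Payoff (n : ℕ) : Type := Fin n → Fin n → ℝ

/-- The bilinear form `xᵀ A y`. -/
def bilin {n : ℕ} (x : Fin n → ℝ) (A : Payoff n) (y : Fin n → ℝ) : ℝ :=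
  ∑ i, ∑ j, x i * A i j * y j

/-- The standard basis vector `e_i`. -/
def basisVec {n : ℕ} (i : Fin n) : Fin n → ℝ := Pi.single i 1

/-- The matrices with all entries in `[-1, 1]`. -/
def payoffBox (n : ℕ) : Set (Payoff n) := {A | ∀ i j, A i j ∈ Set.Icc (-1 : ℝ) 1}

/-- Feasible loss matrices of the first player:
`A ∈ [-1,1]^{n×n}` with `xᵀ A y ≤ e_iᵀ A y + α` for all `i`. -/
def feasibleX {n : ℕ} (α : ℝ) (p : Profile n) : Set (Payoff n) :=
  {A | A ∈ payoffBox n ∧ ∀ i, bilin p.1.1 A p.2.1 ≤ bilin (basisVec i) A p.2.1 + α}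

/-- Feasible loss matrices of the second player:
`B ∈ [-1,1]^{n×n}` with `xᵀ B y ≤ xᵀ B e_j + α` for all `j`. -/
def feasibleY {n : ℕ} (α : ℝ) (p : Profile n) : Set (Payoff n) :=
  {B | B ∈ payoffBox n ∧ ∀ j, bilin p.1.1 B p.2.1 ≤ bilin p.1.1 B (basisVec j) + α}

/-- The general-sum feasible set: pairs `(A, B)` for which `(x, y)` is an `α`-Nash equilibrium. -/
def feasibleGeneralSum {n : ℕ} (α : ℝ) (p : Profile n) : Set (Payoff n × Payoff n) :=
  feasibleX α p ×ˢ feasibleY α p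

/-- The zero-sum feasible set: matrices `A ∈ [-1,1]^{n×n}` with
`xᵀ A e_j - α ≤ xᵀ A y ≤ e_iᵀ A y + α` for all `i, j`. -/
def feasibleZeroSum {n : ℕ} (α : ℝ) (p : Profile n) : Set (Payoff n) :=
  {A | A ∈ payoffBox n ∧ ∀ i j,
    bilin p.1.1 A (basisVec j) - α ≤ bilin p.1.1 A p.2.1 ∧
    bilin p.1.1 A p.2.1 ≤ bilin (basisVec i) A p.2.1 + α}

/-- `π_min(x, y)`: the smallest positive probability occurring in `x` or in `y`. -/
noncomputable def minProb {n : ℕ} (p : Profile n) : ℝ :=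
  min (⨅ i : {i : Fin n // 0 < p.1.1 i}, p.1.1 i) (⨅ j : {j : Fin n // 0 < p.2.1 j}, p.2.1 j)

/-- The law on `Fin n` of an action drawn from the mixed strategy `x`. -/
noncomputable def actionLaw {n : ℕ} (x : Strategy n) : Measure (Fin n) :=
  ∑ i, ENNReal.ofReal (x.1 i) • Measure.dirac i

instance instIsProbabilityMeasureActionLaw {n : ℕ} (x : Strategy n) :
    IsProbabilityMeasure (actionLaw x) := by
  constructor
  have h : ∑ i, ENNReal.ofReal (x.1 i) = 1 := by
    rw [← ENNReal.ofReal_sum_of_nonneg (fun i _ => x.2.1 i), x.2.2, ENNReal.ofReal_one]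
  simpa [actionLaw, Measure.finsetSum_apply] using h

/-- The law of the infinite i.i.d. sequence of observations `(X_t, Y_t) ∼ x × y`. -/
noncomputable def obsLaw {n : ℕ} (p : Profile n) : Measure (ℕ → Fin n × Fin n) :=
  Measure.infinitePi (fun _ => (actionLaw p.1).prod (actionLaw p.2))

/-- The first `t` observations. -/
def history {n : ℕ} (t : ℕ) (ω : ℕ → Fin n × Fin n) : Fin t → Fin n × Fin n :=
  fun k => ω k

/-- A (possibly randomized) sequential learning algorithm which recommends a subset of `M`.
It may use internal randomness `s ∼ seedLaw`, independent of the observations; deterministic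
algorithms are those with a one-point seed space. After `t` observations `h` it decides whether
to stop (`halts t s h`), and if it stops then it outputs the set `recommend t s h`. -/
structure Algorithm (n : ℕ) (M : Type) [PseudoEMetricSpace M] where
  Seed : Type
  [measurableSpaceSeed : MeasurableSpace Seed]
  seedLaw : Measure Seed
  [isProbabilityMeasure_seedLaw : IsProbabilityMeasure seedLaw]
  halts : (t : ℕ) → Seed → (Fin t → Fin n × Fin n) → Prop
  measurableSet_halts : ∀ t h, MeasurableSet {s | halts t s h}
  recommend : (t : ℕ) → Seed → (Fin t → Fin n × Fin n) → Set M
  measurableSet_recommend : ∀ t h (S : Set M) (r : ℝ≥0∞),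
    MeasurableSet {s | r ≤ Metric.hausdorffEDist S (recommend t s h)}

attribute [instance] Algorithm.measurableSpaceSeed Algorithm.isProbabilityMeasure_seedLaw

namespace Algorithm

variable {n : ℕ} {M : Type} [PseudoEMetricSpace M]

/-- The joint law of the internal randomness and the observations when the players use `p`. -/
noncomputable def law (alg : Algorithm n M) (p : Profile n) :
    Measure (alg.Seed × (ℕ → Fin n × Fin n)) :=
  alg.seedLaw.prod (obsLaw p)

/-- The stopping time `τ`: the first `t` at which the algorithm stops (`⊤` if it never stops). -/
noncomputable def stoppingTime (alg : Algorithm n M) (q : alg.Seed × (ℕ → Fin n × Fin n)) : ℕ∞ :=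
  ⨅ (t : ℕ) (_ : alg.halts t q.1 (history t q.2)), (t : ℕ∞)

/-- The expected number of observations `E_{x,y}[τ]`, a value in `[0, ∞]`. -/
noncomputable def expectedTime (alg : Algorithm n M) (p : Profile n) : ℝ≥0∞ :=
  ∫⁻ q, (alg.stoppingTime q : ℝ≥0∞) ∂(alg.law p)

/-- The event that the algorithm stops and outputs a set at Hausdorff distance at least `ε` from
`S`. The distance is extended: an empty output is infinitely far from a nonempty `S`. -/
def errorEvent (alg : Algorithm n M) (S : Set M) (ε : ℝ) :
    Set (alg.Seed × (ℕ → Fin n × Fin n)) :=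
  {q | ∃ t : ℕ, alg.stoppingTime q = t ∧
    ENNReal.ofReal ε ≤ Metric.hausdorffEDist S (alg.recommend t q.1 (history t q.2))}

/-- `(ε, δ)`-correctness over a class `C` of instances, for the problem of learning `target p`:
on each instance of the class, the probability of an erroneous output is at most `δ`. -/
def IsCorrect (alg : Algorithm n M) (target : Profile n → Set M) (C : Set (Profile n))
    (ε δ : ℝ) : Prop :=
  ∀ p ∈ C, alg.law p (alg.errorEvent (target p) ε) ≤ ENNReal.ofReal δ

end Algorithm

/-- The class of instances in which every action played has probability at least `πmin`. -/
def instanceClass (n : ℕ) (πmin : ℝ) : Set (Profile n) := {p | πmin ≤ minProb p}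

end InverseGame

namespace InverseGame

/-! ### Change of measure for the observations -/

/-! Each bound is a hypothesis test among instances whose feasible sets lie at Hausdorff distance at
least 2ε, so that one output cannot be ε-close to two of them.

Information is measured by the second moment of the likelihood ratio. If this is at most exp D for
one observation, Cauchy–Schwarz gives P_p(E)² ≤ P_q(E) exp(D T) for every event E decided within T
observations (`sq_law_stopEvent_le`). Markov's inequality turns a small expected stopping time into
such a fixed horizon T (`exists_horizon`).

The log(1/δ) terms come from three pairwise separated instances (`le_expectedTime_of_separated`).
Two would not do: at δ = 1/2 a fair coin decides between two targets without any sample. A pure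
profile against mixtures that play a second action with probability π costs D = log(1/(1-π)); an
even two-action mixture against biases ±2ε costs D of order ε². The term n/ε² comes from 2^K biased
distributions, K of order n, all within chi-square cost of order ε² of one centre. Only
exponentially few of them have targets close to a common output, and counting finishes the argument
(`exists_le_expectedTime_of_card_le`, `card_le_of_hammingDist_lt`).

Separation is certified by a single zero-sum game A that is feasible for one instance and violates
an equilibrium condition of the other by 4ε (`Violates`). The pair (A, -A) certifies it in the
general-sum problem too, so `lowerBounds` treats both problems at once. -/

/-- The profile `p` is absolutely continuous with respect to `q`, and the second moment under `q`
of the likelihood ratio of one observation is at most `exp D`. -/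
structure ChiSqBound {n : ℕ} (p q : Profile n) (D : ℝ) : Prop where
  ac_fst : ∀ i, q.1.1 i = 0 → p.1.1 i = 0
  ac_snd : ∀ j, q.2.1 j = 0 → p.2.1 j = 0
  le_exp : (∑ i, p.1.1 i ^ 2 / q.1.1 i) * (∑ j, p.2.1 j ^ 2 / q.2.1 j) ≤ Real.exp D

/-- The probability of a finite sequence of observations. -/
def obsWeight {n : ℕ} (p : Profile n) {T : ℕ} (h : Fin T → Fin n × Fin n) : ℝ :=
  ∏ k, p.1.1 (h k).1 * p.2.1 (h k).2

lemma obsWeight_nonneg {n : ℕ} (p : Profile n) {T : ℕ} (h : Fin T → Fin n × Fin n) :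
    0 ≤ obsWeight p h :=
  Finset.prod_nonneg fun _ _ => mul_nonneg (p.1.2.1 _) (p.2.2.1 _)

/-- The second moment is multiplicative over independent observations. The convention x / 0 = 0
respects products, so zero probabilities need no separate treatment here. -/
lemma sum_obsWeight_sq_div {n : ℕ} (p q : Profile n) (T : ℕ) :
    ∑ h : Fin T → Fin n × Fin n, obsWeight p h ^ 2 / obsWeight q h =
      ((∑ i, p.1.1 i ^ 2 / q.1.1 i) * (∑ j, p.2.1 j ^ 2 / q.2.1 j)) ^ T := by
  rw [Finset.sum_mul_sum, ← Finset.sum_product', Finset.univ_product_univ, Fintype.sum_pow]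
  refine Finset.sum_congr rfl fun h _ => ?_
  rw [obsWeight, obsWeight, ← Finset.prod_pow, ← Finset.prod_div_distrib]
  refine Finset.prod_congr rfl fun k _ => ?_
  rw [mul_pow, mul_div_mul_comm]

/-- Cauchy–Schwarz applied to w·p = √(w·q) · √(w·p²/q); absolute continuity covers the histories
with q = 0, and w ≤ 1 is dropped from the second factor. -/
lemma ChiSqBound.sq_sum_le {n : ℕ} {p q : Profile n} {D : ℝ} (hpq : ChiSqBound p q D) {T : ℕ}
    (w : (Fin T → Fin n × Fin n) → ℝ) (hw0 : ∀ h, 0 ≤ w h) (hw1 : ∀ h, w h ≤ 1) :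
    (∑ h, w h * obsWeight p h) ^ 2 ≤ (∑ h, w h * obsWeight q h) * Real.exp (D * T) := by
  have hac : ∀ h : Fin T → Fin n × Fin n, obsWeight q h = 0 → obsWeight p h = 0 := by
    intro h hq
    obtain ⟨k, -, hk⟩ := Finset.prod_eq_zero_iff.1 hq
    refine Finset.prod_eq_zero (Finset.mem_univ k) ?_
    rcases mul_eq_zero.1 hk with hk | hk
    · rw [hpq.ac_fst _ hk, zero_mul]
    · rw [hpq.ac_snd _ hk, mul_zero]
  have h1 : (∑ h, w h * obsWeight p h) ^ 2 ≤
      (∑ h, w h * obsWeight q h) * ∑ h, w h * (obsWeight p h ^ 2 / obsWeight q h) := by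
    refine Finset.sum_sq_le_sum_mul_sum_of_sq_le_mul _
      (fun h _ => mul_nonneg (hw0 h) (obsWeight_nonneg q h))
      (fun h _ => mul_nonneg (hw0 h) (div_nonneg (sq_nonneg _) (obsWeight_nonneg q h)))
      (fun h _ => ?_)
    by_cases hq : obsWeight q h = 0
    · simp [hq, hac h hq]
    · apply le_of_eq
      field_simp
  refine h1.trans (mul_le_mul_of_nonneg_left ?_
    (Finset.sum_nonneg fun h _ => mul_nonneg (hw0 h) (obsWeight_nonneg q h)))
  calc ∑ h, w h * (obsWeight p h ^ 2 / obsWeight q h)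
      ≤ ∑ h, obsWeight p h ^ 2 / obsWeight q h :=
        Finset.sum_le_sum fun h _ => mul_le_of_le_one_left
          (div_nonneg (sq_nonneg _) (obsWeight_nonneg q h)) (hw1 h)
    _ = _ := sum_obsWeight_sq_div p q T
    _ ≤ Real.exp D ^ T := by
        refine pow_le_pow_left₀ (mul_nonneg ?_ ?_) hpq.le_exp T
        · exact Finset.sum_nonneg fun i _ => div_nonneg (sq_nonneg _) (q.1.2.1 i)
        · exact Finset.sum_nonneg fun i _ => div_nonneg (sq_nonneg _) (q.2.2.1 i)
    _ = Real.exp (D * T) := by rw [← Real.exp_nat_mul, mul_comm]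

lemma actionLaw_singleton {n : ℕ} (x : Strategy n) (i : Fin n) :
    actionLaw x {i} = ENNReal.ofReal (x.1 i) := by
  simp [actionLaw, Measure.finsetSum_apply, Set.indicator_apply]

instance {n : ℕ} (p : Profile n) : IsProbabilityMeasure (obsLaw p) := by
  unfold obsLaw; infer_instance

lemma nonempty_of_profile {n : ℕ} (p : Profile n) : Nonempty (Fin n) := by
  by_contra hn
  rw [not_nonempty_iff] at hn
  have h0 : ∑ i, p.1.1 i = 1 := p.1.2.2
  simp at h0

lemma obsLaw_history_eq {n : ℕ} (p : Profile n) {T : ℕ} (h : Fin T → Fin n × Fin n) :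
    obsLaw p {ω | history T ω = h} = ENNReal.ofReal (obsWeight p h) := by
  let t : ℕ → Set (Fin n × Fin n) := fun k => if hk : k < T then {h ⟨k, hk⟩} else Set.univ
  have hset : {ω : ℕ → Fin n × Fin n | history T ω = h} =
      (↑(Finset.range T) : Set ℕ).pi t := by
    ext ω
    simp only [Set.mem_ofPred_eq, Set.mem_pi, Finset.coe_range, Set.mem_Iio, funext_iff, history, t]
    constructor
    · intro hω k hk
      simpa [hk] using hω ⟨k, hk⟩
    · intro hω k
      simpa [k.2] using hω k k.2
  rw [hset, obsLaw, Measure.infinitePi_pi _ (fun i _ => MeasurableSet.of_discrete),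
    Finset.prod_range, obsWeight, ENNReal.ofReal_prod_of_nonneg
      (fun _ _ => mul_nonneg (p.1.2.1 _) (p.2.2.1 _))]
  refine Finset.prod_congr rfl fun k _ => ?_
  have : t k = {(h k).1} ×ˢ {(h k).2} := by
    simp [t, k.2]
  rw [this, Measure.prod_prod, actionLaw_singleton, actionLaw_singleton,
    ENNReal.ofReal_mul (p.1.2.1 _)]

/-! ### Events decided within finitely many observations -/

namespace Algorithm

variable {n : ℕ} {M : Type} [PseudoEMetricSpace M]

instance (alg : Algorithm n M) (p : Profile n) : IsProbabilityMeasure (alg.law p) := by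
  unfold law; infer_instance

lemma stoppingTime_eq_coe_iff (alg : Algorithm n M) (q : alg.Seed × (ℕ → Fin n × Fin n)) (t : ℕ) :
    alg.stoppingTime q = t ↔
      alg.halts t q.1 (history t q.2) ∧ ∀ t' < t, ¬ alg.halts t' q.1 (history t' q.2) := by
  classical
  have key : ∀ m : ℕ, alg.halts m q.1 (history m q.2) →
      (∀ t' < m, ¬ alg.halts t' q.1 (history t' q.2)) → alg.stoppingTime q = m := by
    intro m hm hlt
    refine le_antisymm (iInf₂_le m hm) (le_iInf₂ fun t' ht' => ?_)
    by_contra hcon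
    exact hlt t' (by exact_mod_cast not_le.1 hcon) ht'
  refine ⟨fun h => ?_, fun h => key t h.1 h.2⟩
  by_cases hex : ∃ m, alg.halts m q.1 (history m q.2)
  · have h' := key _ (Nat.find_spec hex) (fun t' ht' => Nat.find_min hex ht')
    have hEq : t = Nat.find hex := by exact_mod_cast h.symm.trans h'
    subst hEq
    exact ⟨Nat.find_spec hex, fun t' ht' => Nat.find_min hex ht'⟩
  · rw [not_exists] at hex
    have : alg.stoppingTime q = ⊤ := by simp [stoppingTime, hex]
    rw [this] at h
    exact absurd h (ENat.top_ne_natCast t)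

/-- The event that the algorithm stops within `T` observations with an output satisfying `R`. -/
def stopEvent (alg : Algorithm n M) (T : ℕ) (R : Set M → Prop) :
    Set (alg.Seed × (ℕ → Fin n × Fin n)) :=
  {q | ∃ t ≤ T, alg.stoppingTime q = t ∧ R (alg.recommend t q.1 (history t q.2))}

/-- The property `R` of outputs is measurable in the internal randomness. -/
def MeasurableProp (alg : Algorithm n M) (R : Set M → Prop) : Prop :=
  ∀ t h, MeasurableSet {s | R (alg.recommend t s h)}

lemma measurableProp_true (alg : Algorithm n M) : alg.MeasurableProp fun _ => True :=
  fun _ _ => MeasurableSet.univ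

lemma measurableProp_le (alg : Algorithm n M) (S : Set M) (r : ℝ≥0∞) :
    alg.MeasurableProp fun O => r ≤ Metric.hausdorffEDist S O :=
  fun t h => alg.measurableSet_recommend t h S r

lemma measurableProp_lt (alg : Algorithm n M) (S : Set M) (r : ℝ≥0∞) :
    alg.MeasurableProp fun O => Metric.hausdorffEDist S O < r := by
  intro t h
  simpa [Set.compl_ofPred] using (alg.measurableSet_recommend t h S r).compl

lemma measurableSet_slice (alg : Algorithm n M) (T : ℕ) {R : Set M → Prop}
    (hR : alg.MeasurableProp R) (ω : ℕ → Fin n × Fin n) :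
    MeasurableSet {s | (s, ω) ∈ alg.stopEvent T R} := by
  simp only [stopEvent, Set.mem_ofPred_eq, stoppingTime_eq_coe_iff]
  have : {s | ∃ t ≤ T, (alg.halts t s (history t ω) ∧ ∀ t' < t, ¬ alg.halts t' s (history t' ω)) ∧
      R (alg.recommend t s (history t ω))} =
      ⋃ t ≤ T, ({s | alg.halts t s (history t ω)} ∩
        ⋂ t' < t, {s | alg.halts t' s (history t' ω)}ᶜ) ∩ {s | R (alg.recommend t s (history t ω))} := by
    ext s; simp; grind
  rw [this]
  refine MeasurableSet.iUnion fun t => MeasurableSet.iUnion fun _ => ?_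
  refine ((alg.measurableSet_halts _ _).inter ?_).inter (hR _ _)
  exact MeasurableSet.iInter fun t' => MeasurableSet.iInter fun _ =>
    (alg.measurableSet_halts _ _).compl

lemma mem_stopEvent_congr (alg : Algorithm n M) {T : ℕ} (R : Set M → Prop) (s : alg.Seed)
    {ω ω' : ℕ → Fin n × Fin n} (h : history T ω = history T ω') :
    (s, ω) ∈ alg.stopEvent T R ↔ (s, ω') ∈ alg.stopEvent T R := by
  have hh : ∀ t ≤ T, history t ω = history t ω' := by
    intro t ht
    funext k
    exact congrFun h ⟨k, k.2.trans_le ht⟩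
  simp only [stopEvent, Set.mem_ofPred_eq, stoppingTime_eq_coe_iff]
  refine exists_congr fun t => and_congr_right fun ht => ?_
  rw [hh t ht]
  refine and_congr (and_congr_right fun _ => forall₂_congr fun t' ht' => ?_) Iff.rfl
  rw [hh t' (ht'.le.trans ht)]

lemma measurableSet_history_eq {T : ℕ} (h : Fin T → Fin n × Fin n) :
    MeasurableSet {ω : ℕ → Fin n × Fin n | history T ω = h} := by
  have : Measurable (history T : (ℕ → Fin n × Fin n) → _) :=
    measurable_pi_lambda _ fun k => measurable_pi_apply _
  exact this (measurableSet_singleton h)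

lemma stopEvent_eq_iUnion (alg : Algorithm n M) (T : ℕ) (R : Set M → Prop)
    (ext : (Fin T → Fin n × Fin n) → ℕ → Fin n × Fin n) (hext : ∀ h, history T (ext h) = h) :
    alg.stopEvent T R = ⋃ h ∈ (Finset.univ : Finset (Fin T → Fin n × Fin n)),
      {s | (s, ext h) ∈ alg.stopEvent T R} ×ˢ {ω | history T ω = h} := by
  ext ⟨s, ω⟩
  simp only [Finset.mem_univ, Set.iUnion_true, Set.mem_iUnion, Set.mem_prod, Set.mem_ofPred_eq,
    exists_eq_right']
  exact alg.mem_stopEvent_congr R s (hext _).symm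

lemma exists_history_extension (p : Profile n) (T : ℕ) :
    ∃ ext : (Fin T → Fin n × Fin n) → ℕ → Fin n × Fin n, ∀ h, history T (ext h) = h := by
  obtain ⟨a⟩ := nonempty_of_profile p
  refine ⟨fun h k => if hk : k < T then h ⟨k, hk⟩ else (a, a), fun h => ?_⟩
  funext k
  simp [history]

lemma measurableSet_stopEvent (alg : Algorithm n M) (p : Profile n) (T : ℕ) {R : Set M → Prop}
    (hR : alg.MeasurableProp R) : MeasurableSet (alg.stopEvent T R) := by
  obtain ⟨ext, hext⟩ := exists_history_extension p T
  rw [alg.stopEvent_eq_iUnion T R ext hext]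
  exact Finset.measurableSet_biUnion _ fun h _ =>
    (alg.measurableSet_slice T hR _).prod (measurableSet_history_eq h)

/-- The weight of a history is the probability, over the seed alone, that the event occurs on it.
Internal randomness thus only replaces an indicator by a [0,1]-valued function, the same for every
profile, and the change of measure concerns finite sums. -/
lemma exists_law_stopEvent_eq [Nonempty (Profile n)] (alg : Algorithm n M) (T : ℕ)
    {R : Set M → Prop} (hR : alg.MeasurableProp R) :
    ∃ w : (Fin T → Fin n × Fin n) → ℝ, (∀ h, 0 ≤ w h) ∧ (∀ h, w h ≤ 1) ∧
      ∀ p : Profile n, (alg.law p).real (alg.stopEvent T R) = ∑ h, w h * obsWeight p h := by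
  obtain ⟨ext, hext⟩ := exists_history_extension (Classical.arbitrary (Profile n)) T
  refine ⟨fun h => alg.seedLaw.real {s | (s, ext h) ∈ alg.stopEvent T R},
    fun h => measureReal_nonneg, fun h => measureReal_le_one, fun p => ?_⟩
  conv_lhs => rw [alg.stopEvent_eq_iUnion T R ext hext]
  rw [measureReal_biUnion_finset]
  · refine Finset.sum_congr rfl fun h _ => ?_
    rw [law, measureReal_prod_prod]
    congr 1
    rw [measureReal_def, obsLaw_history_eq, ENNReal.toReal_ofReal (obsWeight_nonneg p h)]
  · intro h _ h' _ hne
    refine Set.disjoint_left.2 fun q hq hq' => hne ?_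
    exact (Set.mem_prod.1 hq).2.symm.trans (Set.mem_prod.1 hq').2
  · exact fun h _ => (alg.measurableSet_slice T hR _).prod (measurableSet_history_eq h)

/-- Change of measure for events decided within `T` observations. -/
lemma sq_law_stopEvent_le (alg : Algorithm n M) {p q : Profile n} {D : ℝ}
    (hpq : ChiSqBound p q D) (T : ℕ) {R : Set M → Prop} (hR : alg.MeasurableProp R) :
    (alg.law p).real (alg.stopEvent T R) ^ 2 ≤
      (alg.law q).real (alg.stopEvent T R) * Real.exp (D * T) := by
  have : Nonempty (Profile n) := ⟨p⟩
  obtain ⟨w, hw0, hw1, hw⟩ := alg.exists_law_stopEvent_eq T hR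
  rw [hw, hw]
  exact hpq.sq_sum_le w hw0 hw1

/-- Markov's inequality for the stopping time. -/
lemma one_sub_law_stopEvent_le (alg : Algorithm n M) (p : Profile n) (T : ℕ) {E : ℝ} (hE : 0 ≤ E)
    (h : alg.expectedTime p ≤ ENNReal.ofReal E) :
    (T + 1) * (1 - (alg.law p).real (alg.stopEvent T fun _ => True)) ≤ E := by
  have hm := alg.measurableSet_stopEvent p T alg.measurableProp_true
  set A := alg.stopEvent T fun _ => True with hA
  have h1 : ((T : ℝ≥0∞) + 1) * alg.law p Aᶜ ≤ alg.expectedTime p := by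
    rw [expectedTime, ← lintegral_indicator_const hm.compl]
    refine lintegral_mono fun q => ?_
    by_cases hq : q ∈ A
    · simp [hq]
    rw [Set.indicator_of_mem (Set.mem_compl hq)]
    -- Not stopping within T observations means τ ≥ T + 1; this extra 1 is what lets the horizon
    -- below be a floor.
    have hlt : (T : ℕ∞) + 1 ≤ alg.stoppingTime q := by
      refine Order.add_one_le_of_lt ?_
      by_contra hcon
      rw [not_lt] at hcon
      obtain ⟨t, ht⟩ := ENat.ne_top_iff_exists.1 (ne_top_of_le_ne_top (ENat.natCast_ne_top T) hcon)
      rw [← ht] at hcon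
      exact hq ⟨t, by exact_mod_cast hcon, ht.symm, trivial⟩
    simpa using ENat.toENNReal_le.2 hlt
  have h2 := ENNReal.toReal_mono ENNReal.ofReal_ne_top (h1.trans h)
  rw [ENNReal.toReal_ofReal hE, ENNReal.toReal_mul, ← measureReal_def, probReal_compl_eq_one_sub hm]
    at h2
  convert h2 using 2
  rw [ENNReal.toReal_add (by simp) (by simp)]
  simp

lemma stopEvent_mono (alg : Algorithm n M) (T : ℕ) {R R' : Set M → Prop} (h : ∀ O, R O → R' O) :
    alg.stopEvent T R ⊆ alg.stopEvent T R' := by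
  rintro q ⟨t, ht, hq, hR⟩
  exact ⟨t, ht, hq, h _ hR⟩

lemma IsCorrect.law_stopEvent_le {alg : Algorithm n M} {target : Profile n → Set M}
    {C : Set (Profile n)} {ε δ : ℝ} (h : alg.IsCorrect target C ε δ) (hδ : 0 ≤ δ) {p : Profile n}
    (hp : p ∈ C) (T : ℕ) :
    (alg.law p).real (alg.stopEvent T fun O =>
      ENNReal.ofReal ε ≤ Metric.hausdorffEDist (target p) O) ≤ δ := by
  refine ENNReal.toReal_le_of_le_ofReal hδ ((measure_mono ?_).trans (h p hp))
  rintro q ⟨t, -, hq, hR⟩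
  exact ⟨t, hq, hR⟩

lemma law_stopEvent_true_le (alg : Algorithm n M) (p : Profile n) (T : ℕ) (S : Set M) (r : ℝ≥0∞) :
    (alg.law p).real (alg.stopEvent T fun _ => True) ≤
      (alg.law p).real (alg.stopEvent T fun O => Metric.hausdorffEDist S O < r) +
      (alg.law p).real (alg.stopEvent T fun O => r ≤ Metric.hausdorffEDist S O) := by
  refine (measureReal_mono ?_).trans (measureReal_union_le _ _)
  rintro q ⟨t, ht, hq, -⟩
  rcases lt_or_ge (Metric.hausdorffEDist S (alg.recommend t q.1 (history t q.2))) r with hr | hr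
  · exact Or.inl ⟨t, ht, hq, hr⟩
  · exact Or.inr ⟨t, ht, hq, hr⟩

end Algorithm

/-! ### Lower bounds on the expected stopping time from separated instances -/

/-- No set is at Hausdorff distance less than `ε` from both `S` and `S'`, by the triangle
inequality. -/
def Separated {M : Type} [PseudoEMetricSpace M] (ε : ℝ) (S S' : Set M) : Prop :=
  ENNReal.ofReal ε + ENNReal.ofReal ε ≤ Metric.hausdorffEDist S S'

lemma Separated.le_of_lt {M : Type} [PseudoEMetricSpace M] {ε : ℝ} {S S' O : Set M}
    (h : Separated ε S S') (hO : Metric.hausdorffEDist S' O < ENNReal.ofReal ε) :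
    ENNReal.ofReal ε ≤ Metric.hausdorffEDist S O := by
  by_contra! hcon
  refine absurd h (not_le.2 ?_)
  calc Metric.hausdorffEDist S S'
      ≤ Metric.hausdorffEDist S O + Metric.hausdorffEDist O S' := Metric.hausdorffEDist_triangle
    _ < _ := ENNReal.add_lt_add hcon (by rwa [Metric.hausdorffEDist_comm])

namespace Algorithm

variable {n : ℕ} {M : Type} [PseudoEMetricSpace M]

/-- Markov's inequality at level a·E: since a·E < ⌊a·E⌋ + 1, rounding the horizon down costs
nothing, and E = 0 is included. -/
lemma exists_horizon (alg : Algorithm n M) (p : Profile n) {E a : ℝ} (hE : 0 ≤ E) (ha : 0 < a)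
    (h : alg.expectedTime p ≤ ENNReal.ofReal E) :
    1 - 1 / a ≤ (alg.law p).real (alg.stopEvent ⌊a * E⌋₊ fun _ => True) := by
  have h1 := alg.one_sub_law_stopEvent_le p ⌊a * E⌋₊ hE h
  have h2 := Nat.lt_floor_add_one (a * E)
  set P := (alg.law p).real (alg.stopEvent ⌊a * E⌋₊ fun _ => True)
  have hP : P ≤ 1 := measureReal_le_one
  have h3 : a * (1 - P) ≤ 1 := by
    by_contra! hcon
    have h4 : (0 : ℝ) < ⌊a * E⌋₊ + 1 := by positivity
    nlinarith
  have : 1 - P ≤ 1 / a := by rw [le_div_iff₀ ha]; linarith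
  linarith

/-- Under p, an output close to either alternative's target is an error, and these two events are
disjoint, so one of them has probability at most δ/2 ≤ 1/4. For that alternative q the algorithm,
run on p, quickly produces an output that is wrong for q; by the change of measure q would then see
it with probability more than δ. -/
lemma le_expectedTime_of_separated (alg : Algorithm n M) {target : Profile n → Set M}
    {C : Set (Profile n)} {ε δ D : ℝ} (hcorr : alg.IsCorrect target C ε δ)
    (hδ0 : 0 < δ) (hδ : δ ≤ 1 / 2) (hD : 0 < D) {p q₁ q₂ : Profile n}
    (hp : p ∈ C) (hq₁ : q₁ ∈ C) (hq₂ : q₂ ∈ C)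
    (hpq₁ : ChiSqBound p q₁ D) (hpq₂ : ChiSqBound p q₂ D)
    (h₁ : Separated ε (target p) (target q₁)) (h₂ : Separated ε (target p) (target q₂))
    (h₁₂ : Separated ε (target q₁) (target q₂)) :
    ENNReal.ofReal (Real.log (1 / δ) / (640 * D)) ≤ alg.expectedTime p := by
  by_contra! hcon
  have hL : 0 ≤ Real.log (1 / δ) := Real.log_nonneg (by rw [le_div_iff₀ hδ0]; linarith)
  set E := Real.log (1 / δ) / (640 * D) with hE
  have hE0 : 0 ≤ E := by positivity
  have h_halt := alg.exists_horizon p hE0 (a := 64) (by norm_num) hcon.le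
  set T := ⌊64 * E⌋₊
  have hT : (T : ℝ) ≤ 64 * E := Nat.floor_le (by positivity)
  have key : ∀ q ∈ C, ChiSqBound p q D →
      (alg.law p).real (alg.stopEvent T fun O =>
        Metric.hausdorffEDist (target q) O < ENNReal.ofReal ε) ≤ δ / 2 → False := by
    intro q hq hpq hle
    have h3 := alg.law_stopEvent_true_le p T (target q) (ENNReal.ofReal ε)
    have h4 := alg.sq_law_stopEvent_le hpq T (alg.measurableProp_le (target q) (ENNReal.ofReal ε))
    have h5 := hcorr.law_stopEvent_le hδ0.le hq T
    set P := (alg.law p).real (alg.stopEvent T fun O =>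
      ENNReal.ofReal ε ≤ Metric.hausdorffEDist (target q) O)
    -- Stopping within T has probability at least 63/64, and at most 1/4 is lost to outputs close to
    -- the target of q.
    have hP : 47 / 64 ≤ P := by linarith
    have h6 : (47 / 64 : ℝ) ^ 2 ≤ δ * Real.exp (D * T) :=
      (pow_le_pow_left₀ (by norm_num) hP 2).trans
        (h4.trans (mul_le_mul_of_nonneg_right h5 (Real.exp_pos _).le))
    have h7 : Real.exp (D * T) ^ 10 ≤ 1 / δ := by
      rw [← Real.exp_nat_mul, ← Real.le_log_iff_exp_le (by positivity)]
      have : D * (64 * E) * 10 = Real.log (1 / δ) := by rw [hE]; field_simp; ring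
      push_cast
      nlinarith
    -- The horizon gives D·T ≤ log(1/δ)/10. The tenth power therefore turns the exponential into at
    -- most 1/δ, leaving δ⁹ ≤ 2⁻⁹, which is just below (47/64)²⁰.
    have h8 : ((47 / 64 : ℝ) ^ 2) ^ 10 ≤ (1 / 2) ^ 9 :=
      calc ((47 / 64 : ℝ) ^ 2) ^ 10 ≤ (δ * Real.exp (D * T)) ^ 10 :=
            pow_le_pow_left₀ (by norm_num) h6 10
        _ = δ ^ 10 * Real.exp (D * T) ^ 10 := mul_pow _ _ _
        _ ≤ δ ^ 10 * (1 / δ) := mul_le_mul_of_nonneg_left h7 (by positivity)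
        _ = δ ^ 9 := by field_simp
        _ ≤ (1 / 2) ^ 9 := pow_le_pow_left₀ hδ0.le hδ 9
    norm_num at h8
  have hm := alg.measurableSet_stopEvent p T
    (alg.measurableProp_lt (target q₂) (ENNReal.ofReal ε))
  have hsum : (alg.law p).real (alg.stopEvent T fun O =>
        Metric.hausdorffEDist (target q₁) O < ENNReal.ofReal ε) +
      (alg.law p).real (alg.stopEvent T fun O =>
        Metric.hausdorffEDist (target q₂) O < ENNReal.ofReal ε) ≤ δ := by
    rw [← measureReal_union _ hm]
    · refine (measureReal_mono ?_).trans (hcorr.law_stopEvent_le hδ0.le hp T)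
      refine Set.union_subset ?_ ?_
      · exact alg.stopEvent_mono T fun O hO => h₁.le_of_lt hO
      · exact alg.stopEvent_mono T fun O hO => h₂.le_of_lt hO
    · refine Set.disjoint_left.2 ?_
      rintro q ⟨t, -, ht, hO⟩ ⟨t', -, ht', hO'⟩
      obtain rfl : t = t' := by exact_mod_cast ht.symm.trans ht'
      exact absurd (h₁₂.le_of_lt hO') (not_le.2 hO)
  rcases le_or_gt ((alg.law p).real (alg.stopEvent T fun O =>
    Metric.hausdorffEDist (target q₁) O < ENNReal.ofReal ε)) (δ / 2) with h | h
  · exact key q₁ hq₁ hpq₁ h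
  · exact key q₂ hq₂ hpq₂ (by linarith)

/-- The sum is the expected number of indices whose target is close to the output, and this number
is at most N pointwise. -/
lemma sum_law_stopEvent_le (alg : Algorithm n M) (p : Profile n) (T : ℕ) {S : Type} [Fintype S]
    (F : S → Set M) (r : ℝ≥0∞) (N : ℝ)
    (hN : ∀ (O : Set M) (A : Finset S), (∀ s ∈ A, Metric.hausdorffEDist (F s) O < r) →
      (A.card : ℝ) ≤ N) :
    ∑ s, (alg.law p).real (alg.stopEvent T fun O => Metric.hausdorffEDist (F s) O < r) ≤ N := by
  classical
  have hm : ∀ s, MeasurableSet (alg.stopEvent T fun O => Metric.hausdorffEDist (F s) O < r) :=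
    fun s => alg.measurableSet_stopEvent p T (alg.measurableProp_lt (F s) r)
  set G : S → Set (alg.Seed × (ℕ → Fin n × Fin n)) :=
    fun s => alg.stopEvent T fun O => Metric.hausdorffEDist (F s) O < r with hG
  have hint : ∀ s, Integrable ((G s).indicator (1 : alg.Seed × (ℕ → Fin n × Fin n) → ℝ)) (alg.law p) :=
    fun s => (integrable_const (1 : ℝ)).indicator (hm s)
  have h1 : ∑ s, (alg.law p).real (G s) = ∫ q, ∑ s, (G s).indicator (1 : alg.Seed × (ℕ → Fin n × Fin n) → ℝ) q ∂alg.law p := by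
    rw [integral_finsetSum _ fun s _ => hint s]
    exact Finset.sum_congr rfl fun s _ => (integral_indicator_one (hm s)).symm
  rw [h1]
  have h2 : ∫ q, ∑ s, (G s).indicator (1 : alg.Seed × (ℕ → Fin n × Fin n) → ℝ) q ∂alg.law p ≤ ∫ _, N ∂alg.law p := by
    refine integral_mono (integrable_finsetSum _ fun s _ => hint s) (integrable_const N)
      fun q => ?_
    have h3 : ∑ s, (G s).indicator (1 : alg.Seed × (ℕ → Fin n × Fin n) → ℝ) q =
        ((Finset.univ.filter fun s => q ∈ G s).card : ℝ) := by
      simp [Set.indicator_apply, Finset.sum_boole]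
    simp only [h3]
    by_cases h_halt : ∃ t ≤ T, alg.stoppingTime q = t
    · obtain ⟨t, -, ht⟩ := h_halt
      refine hN (alg.recommend t q.1 (history t q.2)) _ fun s hs => ?_
      obtain ⟨t', -, ht', hO⟩ := (Finset.mem_filter.1 hs).2
      obtain rfl : t = t' := by exact_mod_cast ht.symm.trans ht'
      exact hO
    · rw [Finset.filter_false_of_mem]
      -- Without an output the count is zero; the empty family supplies 0 ≤ N.
      · simpa using hN ∅ ∅ (by simp)
      · rintro s - ⟨t, hle, ht, -⟩
        exact h_halt ⟨t, hle, ht⟩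
  simpa using h2

/-- If at most `N` of the targets are close to any output then, for some instance of the family,
the stopping time is large. -/
lemma exists_le_expectedTime_of_card_le (alg : Algorithm n M) {target : Profile n → Set M}
    {C : Set (Profile n)} {ε δ D N E : ℝ} (hcorr : alg.IsCorrect target C ε δ)
    (hδ0 : 0 < δ) (hδ : δ ≤ 1 / 2) (hD : 0 ≤ D) (hE : 0 ≤ E) {S : Type} [Fintype S]
    (q : S → Profile n) (q₀ : Profile n) (hq : ∀ s, q s ∈ C)
    (hchi : ∀ s, ChiSqBound (q s) q₀ D)
    (hN : ∀ (O : Set M) (A : Finset S),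
      (∀ s ∈ A, Metric.hausdorffEDist (target (q s)) O < ENNReal.ofReal ε) → (A.card : ℝ) ≤ N)
    (hlt : N * Real.exp (4 * D * E) < Fintype.card S / 16) :
    ∃ s, ENNReal.ofReal E ≤ alg.expectedTime (q s) := by
  by_contra! hcon
  set T := ⌊4 * E⌋₊ with hTdef
  have hT : (T : ℝ) ≤ 4 * E := Nat.floor_le (by positivity)
  have h1 : ∀ s, (1 / 16 : ℝ) ≤ (alg.law q₀).real (alg.stopEvent T fun O =>
      Metric.hausdorffEDist (target (q s)) O < ENNReal.ofReal ε) * Real.exp (4 * D * E) := by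
    intro s
    have h_halt := alg.exists_horizon (q s) hE (a := 4) (by norm_num) (hcon s).le
    rw [← hTdef] at h_halt
    have h3 := alg.law_stopEvent_true_le (q s) T (target (q s)) (ENNReal.ofReal ε)
    have h5 := hcorr.law_stopEvent_le hδ0.le (hq s) T
    have h4 := alg.sq_law_stopEvent_le (hchi s) T
      (alg.measurableProp_lt (target (q s)) (ENNReal.ofReal ε))
    -- 3/4 for stopping in time, minus δ ≤ 1/2 for an error. Only the instances q s need
    -- correctness; q₀ merely serves as the common reference measure.
    have h6 : (1 / 4 : ℝ) ≤ (alg.law (q s)).real (alg.stopEvent T fun O =>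
      Metric.hausdorffEDist (target (q s)) O < ENNReal.ofReal ε) := by linarith
    calc (1 / 16 : ℝ) = (1 / 4) ^ 2 := by norm_num
      _ ≤ _ := pow_le_pow_left₀ (by norm_num) h6 2
      _ ≤ _ := h4
      _ ≤ _ := by
        refine mul_le_mul_of_nonneg_left (Real.exp_le_exp.2 ?_) measureReal_nonneg
        nlinarith
  have h2 := Finset.sum_le_sum fun s (_ : s ∈ Finset.univ) => h1 s
  rw [← Finset.sum_mul] at h2
  have h3 := mul_le_mul_of_nonneg_right
    (alg.sum_law_stopEvent_le q₀ T (fun s => target (q s)) (ENNReal.ofReal ε) N hN)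
    (Real.exp_pos (4 * D * E)).le
  simp only [Finset.sum_const, Finset.card_univ, nsmul_eq_mul] at h2
  linarith

end Algorithm

/-! ### Separation of feasible sets -/

lemma bilin_basisVec_left {n : ℕ} (i : Fin n) (A : Payoff n) (y : Fin n → ℝ) :
    bilin (basisVec i) A y = ∑ j, A i j * y j := by
  rw [bilin, Finset.sum_eq_single i]
  · simp [basisVec]
  · intro k _ hk
    simp [basisVec, Pi.single_eq_of_ne hk]
  · simp

lemma bilin_basisVec_right {n : ℕ} (x : Fin n → ℝ) (A : Payoff n) (j : Fin n) :
    bilin x A (basisVec j) = ∑ i, x i * A i j := by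
  refine Finset.sum_congr rfl fun i _ => ?_
  rw [Finset.sum_eq_single j]
  · simp [basisVec]
  · intro k _ hk
    simp [basisVec, Pi.single_eq_of_ne hk]
  · simp

lemma bilin_eq_sum_left {n : ℕ} (x : Fin n → ℝ) (A : Payoff n) (y : Fin n → ℝ) :
    bilin x A y = ∑ i, x i * bilin (basisVec i) A y := by
  simp only [bilin_basisVec_left, Finset.mul_sum]
  simp only [bilin, mul_assoc]

lemma bilin_eq_sum_right {n : ℕ} (x : Fin n → ℝ) (A : Payoff n) (y : Fin n → ℝ) :
    bilin x A y = ∑ j, y j * bilin x A (basisVec j) := by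
  simp only [bilin_basisVec_right, Finset.mul_sum]
  rw [bilin, Finset.sum_comm]
  exact Finset.sum_congr rfl fun j _ => Finset.sum_congr rfl fun i _ => by ring

lemma bilin_neg {n : ℕ} (x : Fin n → ℝ) (A : Payoff n) (y : Fin n → ℝ) :
    bilin x (-A) y = -bilin x A y := by
  simp [bilin, Finset.sum_neg_distrib]

/-- The nonnegative quantities f k - v have x-average zero, hence vanish wherever x is positive. -/
lemma sum_mul_eq_of_forall_le {n : ℕ} (x : Strategy n) (f : Fin n → ℝ)
    (h : ∀ i, ∑ k, x.1 k * f k ≤ f i) {i : Fin n} (hi : 0 < x.1 i) :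
    f i = ∑ k, x.1 k * f k := by
  set v := ∑ k, x.1 k * f k with hv
  have h0 : ∑ k, x.1 k * (f k - v) = 0 := by
    have h1 : ∑ k, x.1 k = 1 := x.2.2
    simp [mul_sub, Finset.sum_sub_distrib, ← Finset.sum_mul, h1, ← hv]
  have h2 := (Finset.sum_eq_zero_iff_of_nonneg
    (fun k _ => mul_nonneg (x.2.1 k) (sub_nonneg.2 (h k)))).1 h0 i (Finset.mem_univ i)
  rcases mul_eq_zero.1 h2 with h3 | h3
  · exact absurd h3 hi.ne'
  · linarith

/-- Complementary slackness: actions in the support of `x` are best responses. -/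
lemma bilin_le_of_mem_feasibleX {n : ℕ} {p : Profile n} {A : Payoff n} (hA : A ∈ feasibleX 0 p)
    {i : Fin n} (hi : 0 < p.1.1 i) (k : Fin n) :
    bilin (basisVec i) A p.2.1 ≤ bilin (basisVec k) A p.2.1 := by
  have h : ∀ i, bilin p.1.1 A p.2.1 ≤ bilin (basisVec i) A p.2.1 := fun i => by
    simpa using hA.2 i
  rw [bilin_eq_sum_left] at h
  rw [sum_mul_eq_of_forall_le p.1 _ h hi]
  exact h k

/-- Complementary slackness: actions in the support of `y` are best responses. -/
lemma bilin_le_of_mem_feasibleY {n : ℕ} {p : Profile n} {B : Payoff n} (hB : B ∈ feasibleY 0 p)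
    {j : Fin n} (hj : 0 < p.2.1 j) (k : Fin n) :
    bilin p.1.1 B (basisVec j) ≤ bilin p.1.1 B (basisVec k) := by
  have h : ∀ j, bilin p.1.1 B p.2.1 ≤ bilin p.1.1 B (basisVec j) := fun j => by
    simpa using hB.2 j
  rw [bilin_eq_sum_right] at h
  rw [sum_mul_eq_of_forall_le p.2 _ h hj]
  exact h k

/-- This is how a zero-sum witness A becomes the general-sum witness (A, -A). -/
lemma mem_feasibleZeroSum_iff {n : ℕ} {p : Profile n} {A : Payoff n} :
    A ∈ feasibleZeroSum 0 p ↔ A ∈ feasibleX 0 p ∧ -A ∈ feasibleY 0 p := by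
  obtain ⟨a⟩ := nonempty_of_profile p
  have hbox : -A ∈ payoffBox n ↔ A ∈ payoffBox n := by
    simp only [payoffBox, Set.mem_ofPred_eq, Set.mem_Icc, Pi.neg_apply]
    exact forall₂_congr fun i j => ⟨fun h => ⟨by linarith, by linarith⟩,
      fun h => ⟨by linarith, by linarith⟩⟩
  simp only [feasibleZeroSum, feasibleX, feasibleY, Set.mem_ofPred_eq, hbox, bilin_neg]
  constructor
  · rintro ⟨h, h'⟩
    exact ⟨⟨h, fun i => (h' i a).2⟩, h, fun j => by linarith [(h' a j).1]⟩
  · rintro ⟨⟨h, h1⟩, -, h2⟩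
    exact ⟨h, fun i j => ⟨by linarith [h2 j], h1 i⟩⟩

/-- The expected payoff changes by at most the entrywise distance. -/
lemma abs_bilin_sub_le {n : ℕ} (x y : Strategy n) (A B : Payoff n) :
    |bilin x.1 A y.1 - bilin x.1 B y.1| ≤ dist A B := by
  have hx : ∑ i, x.1 i = 1 := x.2.2
  have hy : ∑ i, y.1 i = 1 := y.2.2
  calc |bilin x.1 A y.1 - bilin x.1 B y.1|
      = |∑ i, ∑ j, x.1 i * y.1 j * (A i j - B i j)| := by
        simp only [bilin, ← Finset.sum_sub_distrib]
        congr 1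
        exact Finset.sum_congr rfl fun i _ => Finset.sum_congr rfl fun j _ => by ring
    _ ≤ ∑ i, ∑ j, x.1 i * y.1 j * dist A B := by
        refine (Finset.abs_sum_le_sum_abs _ _).trans (Finset.sum_le_sum fun i _ => ?_)
        refine (Finset.abs_sum_le_sum_abs _ _).trans (Finset.sum_le_sum fun j _ => ?_)
        rw [abs_mul, abs_of_nonneg (mul_nonneg (x.2.1 i) (y.2.1 j))]
        refine mul_le_mul_of_nonneg_left ?_ (mul_nonneg (x.2.1 i) (y.2.1 j))
        rw [← Real.dist_eq]
        exact (dist_le_pi_dist (A i) (B i) j).trans (dist_le_pi_dist A B i)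
    _ = dist A B := by
        simp only [← Finset.sum_mul, ← Finset.mul_sum, hx, hy, one_mul, mul_one]

/-- The strategy that plays the action `i` with certainty. -/
def pureStrategy {n : ℕ} (i : Fin n) : Strategy n := ⟨basisVec i, single_mem_stdSimplex ℝ i⟩

/-- Some game feasible for `p` violates an equilibrium condition of `q` by at least `2 * r`. -/
def Violates {n : ℕ} (r : ℝ) (p q : Profile n) : Prop :=
  ∃ A ∈ feasibleZeroSum 0 p,
    (∃ i k, 0 < q.1.1 i ∧
      bilin (basisVec k) A q.2.1 + 2 * r ≤ bilin (basisVec i) A q.2.1) ∨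
    (∃ j k, 0 < q.2.1 j ∧
      bilin q.1.1 A (basisVec j) + 2 * r ≤ bilin q.1.1 A (basisVec k))

/-- A feasible A' has to close a gap of 2r between two expected losses, each of which moves by at
most the entrywise distance. -/
lemma le_dist_of_mem_feasibleX {n : ℕ} {q : Profile n} {A A' : Payoff n} {r : ℝ} {i k : Fin n}
    (hi : 0 < q.1.1 i) (h : bilin (basisVec k) A q.2.1 + 2 * r ≤ bilin (basisVec i) A q.2.1)
    (hA' : A' ∈ feasibleX 0 q) : r ≤ dist A A' := by
  have h1 := abs_le.1 (abs_bilin_sub_le (pureStrategy i) q.2 A A')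
  have h2 := abs_le.1 (abs_bilin_sub_le (pureStrategy k) q.2 A A')
  have h3 := bilin_le_of_mem_feasibleX hA' hi k
  simp only [pureStrategy] at h1 h2
  linarith

lemma le_dist_neg_of_mem_feasibleY {n : ℕ} {q : Profile n} {A B' : Payoff n} {r : ℝ} {j k : Fin n}
    (hj : 0 < q.2.1 j) (h : bilin q.1.1 A (basisVec j) + 2 * r ≤ bilin q.1.1 A (basisVec k))
    (hB' : B' ∈ feasibleY 0 q) : r ≤ dist (-A) B' := by
  have h1 := abs_le.1 (abs_bilin_sub_le q.1 (pureStrategy j) (-A) B')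
  have h2 := abs_le.1 (abs_bilin_sub_le q.1 (pureStrategy k) (-A) B')
  have h3 := bilin_le_of_mem_feasibleY hB' hj k
  simp only [pureStrategy, bilin_neg] at h1 h2
  linarith

lemma separated_of_forall_le_dist {M : Type} [PseudoMetricSpace M] {ε : ℝ} (hε : 0 ≤ ε)
    {S S' : Set M} {a : M} (ha : a ∈ S) (h : ∀ b ∈ S', 2 * ε ≤ dist a b) : Separated ε S S' := by
  refine le_trans ?_ (Metric.infEDist_le_hausdorffEDist_of_mem ha)
  rw [Metric.le_infEDist]
  intro b hb
  rw [edist_dist, ← ENNReal.ofReal_add hε hε, ← two_mul]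
  exact ENNReal.ofReal_le_ofReal (h b hb)

lemma Violates.separated_zeroSum {n : ℕ} {ε : ℝ} (hε : 0 ≤ ε) {p q : Profile n}
    (h : Violates (2 * ε) p q) : Separated ε (feasibleZeroSum 0 p) (feasibleZeroSum 0 q) := by
  obtain ⟨A, hA, h⟩ := h
  refine separated_of_forall_le_dist hε hA fun A' hA' => ?_
  obtain ⟨h1, h2⟩ := mem_feasibleZeroSum_iff.1 hA'
  rcases h with ⟨i, k, hi, h⟩ | ⟨j, k, hj, h⟩
  · exact le_dist_of_mem_feasibleX hi h h1
  · simpa using le_dist_neg_of_mem_feasibleY hj h h2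

lemma Violates.separated_generalSum {n : ℕ} {ε : ℝ} (hε : 0 ≤ ε) {p q : Profile n}
    (h : Violates (2 * ε) p q) :
    Separated ε (feasibleGeneralSum 0 p) (feasibleGeneralSum 0 q) := by
  obtain ⟨A, hA, h⟩ := h
  have hA2 : (A, -A) ∈ feasibleGeneralSum 0 p := mem_feasibleZeroSum_iff.1 hA
  refine separated_of_forall_le_dist hε hA2 fun b hb => ?_
  rw [Prod.dist_eq]
  rcases h with ⟨i, k, hi, h⟩ | ⟨j, k, hj, h⟩
  · exact le_max_of_le_left (le_dist_of_mem_feasibleX hi h hb.1)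
  · exact le_max_of_le_right (le_dist_neg_of_mem_feasibleY hj h hb.2)

/-! ### Three families of games -/

/-- The game whose loss depends only on the first player's action. -/
lemma violates_of_support_fst {n : ℕ} {i k : Fin n} (hik : i ≠ k) (y : Strategy n) {q : Profile n}
    (hq : 0 < q.1.1 k) {r : ℝ} (hr : r ≤ 1) : Violates r (pureStrategy i, y) q := by
  have hrow : ∀ (z : Strategy n) (l : Fin n),
      bilin (basisVec l) (fun a _ => if a = i then -1 else 1) z.1 = if l = i then -1 else 1 := by
    intro z l
    have hz : ∑ j, z.1 j = 1 := z.2.2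
    rw [bilin_basisVec_left, ← Finset.mul_sum, hz, mul_one]
  refine ⟨fun a _ => if a = i then -1 else 1, ⟨fun a _ => ?_, fun a j => ?_⟩, Or.inl ⟨k, i, hq, ?_⟩⟩
  · dsimp only
    split_ifs <;> norm_num
  · have h1 := hrow y i
    have h2 := hrow (pureStrategy j) i
    simp only [pureStrategy, if_true] at h1 h2 ⊢
    rw [h1, h2, hrow]
    refine ⟨by norm_num, ?_⟩
    split_ifs <;> norm_num
  · rw [hrow, hrow, if_pos rfl, if_neg hik.symm]
    linarith

/-- The game whose loss depends only on the second player's action. -/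
lemma violates_of_support_snd {n : ℕ} {j k : Fin n} (hjk : j ≠ k) (x : Strategy n) {q : Profile n}
    (hq : 0 < q.2.1 k) {r : ℝ} (hr : r ≤ 1) : Violates r (x, pureStrategy j) q := by
  have hcol : ∀ (z : Strategy n) (l : Fin n),
      bilin z.1 (fun _ b => if b = j then 1 else -1) (basisVec l) = if l = j then 1 else -1 := by
    intro z l
    have hz : ∑ j, z.1 j = 1 := z.2.2
    rw [bilin_basisVec_right, ← Finset.sum_mul, hz, one_mul]
  refine ⟨fun _ b => if b = j then 1 else -1, ⟨fun _ b => ?_, fun a b => ?_⟩, Or.inr ⟨k, j, hq, ?_⟩⟩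
  · dsimp only
    split_ifs <;> norm_num
  · have h1 := hcol x j
    have h2 := hcol (pureStrategy a) j
    simp only [pureStrategy, if_true] at h1 h2 ⊢
    rw [h1, h2, hcol]
    refine ⟨?_, by norm_num⟩
    split_ifs <;> norm_num
  · rw [hcol, hcol, if_pos rfl, if_neg hjk.symm]
    linarith

/-- The game in which the second player chooses between a zero loss and the loss vector `b`. -/
lemma violates_of_loss_vector {n : ℕ} {j k : Fin n} (hjk : j ≠ k) {x x' : Strategy n}
    {b : Fin n → ℝ} (hb : ∀ i, b i ∈ Set.Icc (-1 : ℝ) 1) {r : ℝ}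
    (hx : ∑ i, x.1 i * b i ≤ 0) (hx' : 2 * r ≤ ∑ i, x'.1 i * b i) :
    Violates r (x, pureStrategy j) (x', pureStrategy j) := by
  have hcol : ∀ (z : Fin n → ℝ) (l : Fin n),
      bilin z (fun a c => if c = j then 0 else b a) (basisVec l) =
        if l = j then 0 else ∑ i, z i * b i := by
    intro z l
    rw [bilin_basisVec_right]
    split_ifs <;> simp
  refine ⟨fun a c => if c = j then 0 else b a, ⟨fun a c => ?_, fun a c => ?_⟩,
    Or.inr ⟨j, k, by simp [pureStrategy, basisVec], ?_⟩⟩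
  · dsimp only
    split_ifs
    · norm_num
    · exact hb a
  · simp only [pureStrategy, hcol, if_true]
    refine ⟨?_, by norm_num⟩
    split_ifs
    · norm_num
    · linarith
  · rw [hcol, hcol, if_pos rfl, if_neg hjk.symm]
    linarith

/-! ### Instances -/

lemma sum_extend_mul {α : Type} [Fintype α] {n : ℕ} (e : α ↪ Fin n) (v : α → ℝ)
    (f : Fin n → ℝ) : ∑ i, Function.extend e v 0 i * f i = ∑ a, v a * f (e a) := by
  symm
  refine Fintype.sum_of_injective e e.injective _ _ (fun i hi => ?_) (fun a => ?_)
  · rw [Function.extend_apply' _ _ _ (by simpa using hi)]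
    simp
  · rw [e.injective.extend_apply]

/-- Actions outside the range contribute 0 / 0 = 0. -/
lemma sum_extend_sq_div_extend {α : Type} [Fintype α] {n : ℕ} (e : α ↪ Fin n) (u v : α → ℝ) :
    ∑ i, Function.extend e v 0 i ^ 2 / Function.extend e u 0 i = ∑ a, v a ^ 2 / u a := by
  simp only [sq, mul_div_assoc]
  rw [sum_extend_mul]
  simp only [e.injective.extend_apply]

/-- The distribution `v` on `α` transported along an embedding of `α` into the actions. -/
noncomputable def spread {α : Type} [Fintype α] {n : ℕ} (e : α ↪ Fin n) (v : stdSimplex ℝ α) : Strategy n :=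
  ⟨Function.extend e v.1 0, fun i => by
    by_cases hi : ∃ a, e a = i
    · obtain ⟨a, rfl⟩ := hi
      rw [e.injective.extend_apply]
      exact v.2.1 a
    · rw [Function.extend_apply' _ _ _ hi]
      exact le_rfl, by
    have h := sum_extend_mul e v.1 1
    simpa [v.2.2] using h⟩

lemma spread_apply {α : Type} [Fintype α] {n : ℕ} (e : α ↪ Fin n) (v : stdSimplex ℝ α) (a : α) :
    (spread e v).1 (e a) = v.1 a :=
  e.injective.extend_apply _ _ _

lemma le_spread_of_pos {α : Type} [Fintype α] {n : ℕ} (e : α ↪ Fin n) (v : stdSimplex ℝ α) {π : ℝ}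
    (h : ∀ a, 0 < v.1 a → π ≤ v.1 a) (i : Fin n) (hi : 0 < (spread e v).1 i) :
    π ≤ (spread e v).1 i := by
  by_cases hi' : ∃ a, e a = i
  · obtain ⟨a, rfl⟩ := hi'
    rw [spread_apply] at hi ⊢
    exact h a hi
  · have : (spread e v).1 i = 0 := Function.extend_apply' _ _ _ hi'
    exact absurd this hi.ne'

lemma spread_eq_zero_of_spread_eq_zero {α : Type} [Fintype α] {n : ℕ} (e : α ↪ Fin n)
    (v u : stdSimplex ℝ α) (hu : ∀ a, u.1 a ≠ 0) (i : Fin n) (hi : (spread e u).1 i = 0) :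
    (spread e v).1 i = 0 := by
  by_cases hi' : ∃ a, e a = i
  · obtain ⟨a, rfl⟩ := hi'
    rw [spread_apply] at hi
    exact absurd hi (hu a)
  · exact Function.extend_apply' _ _ _ hi'

lemma mem_instanceClass {n : ℕ} {p : Profile n} {π : ℝ} (h₁ : ∀ i, 0 < p.1.1 i → π ≤ p.1.1 i)
    (h₂ : ∀ j, 0 < p.2.1 j → π ≤ p.2.1 j) : p ∈ instanceClass n π := by
  have hne : ∀ x : Strategy n, Nonempty {i : Fin n // 0 < x.1 i} := by
    intro x
    by_contra hcon
    simp only [nonempty_subtype, not_exists, not_lt] at hcon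
    have h0 : ∑ i, x.1 i = 1 := x.2.2
    linarith [Finset.sum_nonpos fun i (_ : i ∈ Finset.univ) => hcon i]
  have := hne p.1
  have := hne p.2
  unfold instanceClass minProb
  rw [Set.mem_ofPred_eq]
  exact le_min (le_ciInf fun i => h₁ i i.2) (le_ciInf fun j => h₂ j j.2)

lemma le_pureStrategy_of_pos {n : ℕ} (j : Fin n) {π : ℝ} (hπ : π ≤ 1) (i : Fin n)
    (hi : 0 < (pureStrategy j).1 i) : π ≤ (pureStrategy j).1 i := by
  by_cases h : i = j
  · subst h
    simpa [pureStrategy, basisVec] using hπ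
  · simp [pureStrategy, basisVec, Pi.single_eq_of_ne h] at hi

lemma sum_pureStrategy_sq_div {n : ℕ} (j : Fin n) (f : Fin n → ℝ) :
    ∑ i, (pureStrategy j).1 i ^ 2 / f i = 1 / f j := by
  rw [Finset.sum_eq_single j]
  · simp [pureStrategy, basisVec]
  · intro k _ hk
    simp [pureStrategy, basisVec, Pi.single_eq_of_ne hk]
  · simp

lemma pureStrategy_eq_zero {n : ℕ} {j : Fin n} {f : Fin n → ℝ} (hf : f j ≠ 0) (i : Fin n)
    (hi : f i = 0) : (pureStrategy j).1 i = 0 := by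
  have : i ≠ j := by rintro rfl; exact hf hi
  simp [pureStrategy, basisVec, Pi.single_eq_of_ne this]

lemma chiSqBound_pureStrategy_snd {n : ℕ} {x x' : Strategy n} (j : Fin n) {D : ℝ}
    (hac : ∀ i, x'.1 i = 0 → x.1 i = 0) (h : ∑ i, x.1 i ^ 2 / x'.1 i ≤ Real.exp D) :
    ChiSqBound (x, pureStrategy j) (x', pureStrategy j) D where
  ac_fst := hac
  ac_snd := fun _ h => h
  le_exp := by
    rw [sum_pureStrategy_sq_div]
    simpa [pureStrategy, basisVec] using h

/-- The strategy playing `i` with probability `a` and `k` with probability `1 - a`. -/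
noncomputable def twoPoint {n : ℕ} {i k : Fin n} (hik : i ≠ k) (a : ℝ) (h0 : 0 ≤ a) (h1 : a ≤ 1) : Strategy n :=
  spread ⟨fun b : Bool => cond b i k, by
      intro b b' h
      cases b <;> cases b' <;> simp_all [Ne.symm]⟩
    ⟨fun b => cond b a (1 - a), fun b => by cases b <;> simp [h0, h1], by simp⟩

section twoPoint

variable {n : ℕ} {i k : Fin n} (hik : i ≠ k) {a : ℝ} (h0 : 0 ≤ a) (h1 : a ≤ 1)

lemma twoPoint_apply_fst : (twoPoint hik a h0 h1).1 i = a :=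
  spread_apply _ _ true

lemma twoPoint_apply_snd : (twoPoint hik a h0 h1).1 k = 1 - a :=
  spread_apply _ _ false

lemma le_twoPoint_of_pos {π : ℝ} (ha : π ≤ a) (ha' : π ≤ 1 - a) (l : Fin n)
    (hl : 0 < (twoPoint hik a h0 h1).1 l) : π ≤ (twoPoint hik a h0 h1).1 l :=
  le_spread_of_pos _ _ (by rintro (_ | _) - <;> simpa) l hl

lemma sum_twoPoint_mul (f : Fin n → ℝ) :
    ∑ l, (twoPoint hik a h0 h1).1 l * f l = a * f i + (1 - a) * f k := by
  refine (sum_extend_mul _ _ f).trans ?_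
  rw [Fintype.sum_bool]
  rfl

end twoPoint

/-- Uniform marginals on the first factor, with a bias of size `η` towards `s` on each pair. -/
noncomputable def biased {K : ℕ} [NeZero K] (η : ℝ) (h0 : 0 ≤ η) (h1 : η ≤ 1)
    (s : Fin K → Bool) : stdSimplex ℝ (Fin K × Bool) :=
  ⟨fun a => (1 + η * (cond (s a.1) 1 (-1) * cond a.2 1 (-1))) / (2 * K), fun a => by
    refine div_nonneg ?_ (by positivity)
    cases s a.1 <;> cases a.2 <;> simp <;> linarith, by
    have hK : (K : ℝ) ≠ 0 := Nat.cast_ne_zero.2 (NeZero.ne K)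
    rw [Fintype.sum_prod_type]
    simp only [Fintype.sum_bool, cond_true, cond_false]
    have : ∀ k : Fin K, (1 + η * (cond (s k) 1 (-1) * 1)) / (2 * (K : ℝ)) +
        (1 + η * (cond (s k) 1 (-1) * -1)) / (2 * (K : ℝ)) = 1 / K := by
      intro k
      field_simp
      ring
    simp only [this, Finset.sum_const, Finset.card_univ, Fintype.card_fin, nsmul_eq_mul]
    field_simp⟩

/-- A loss vector that separates the distributions biased towards `s` and towards `s'`. -/
noncomputable def separatingLoss {K : ℕ} (s s' : Fin K → Bool) (a : Fin K × Bool) : ℝ :=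
  cond a.2 1 (-1) * (cond (s' a.1) 1 (-1) - cond (s a.1) 1 (-1)) / 2

lemma separatingLoss_mem {K : ℕ} (s s' : Fin K → Bool) (a : Fin K × Bool) :
    separatingLoss s s' a ∈ Set.Icc (-1 : ℝ) 1 := by
  simp only [separatingLoss]
  cases s a.1 <;> cases s' a.1 <;> cases a.2 <;> norm_num

section biased

variable {K : ℕ} [NeZero K] {η : ℝ} (h0 : 0 ≤ η) (h1 : η ≤ 1)

lemma biased_zero_apply (s : Fin K → Bool) (a : Fin K × Bool) :
    (biased 0 le_rfl zero_le_one s).1 a = 1 / (2 * K) := by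
  simp [biased]

lemma le_biased_apply (s : Fin K → Bool) (a : Fin K × Bool) :
    (1 - η) / (2 * K) ≤ (biased η h0 h1 s).1 a := by
  simp only [biased]
  refine div_le_div_of_nonneg_right ?_ (by positivity)
  cases s a.1 <;> cases a.2 <;> simp <;> linarith

/-- The terms linear in η cancel within each pair. The value does not depend on K, so the number of
hypotheses grows exponentially at fixed information per observation. -/
lemma sum_biased_sq_div (s s' : Fin K → Bool) :
    ∑ a, (biased η h0 h1 s).1 a ^ 2 / (biased 0 le_rfl zero_le_one s').1 a = 1 + η ^ 2 := by
  have hK : (K : ℝ) ≠ 0 := Nat.cast_ne_zero.2 (NeZero.ne K)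
  rw [Fintype.sum_prod_type]
  simp only [biased_zero_apply, Fintype.sum_bool]
  have : ∀ k : Fin K, (biased η h0 h1 s).1 (k, true) ^ 2 / (1 / (2 * (K : ℝ))) +
      (biased η h0 h1 s).1 (k, false) ^ 2 / (1 / (2 * (K : ℝ))) = (1 + η ^ 2) / K := by
    intro k
    simp only [biased]
    cases s k <;> simp <;> field_simp <;> ring
  simp only [this, Finset.sum_const, Finset.card_univ, Fintype.card_fin, nsmul_eq_mul]
  field_simp

lemma sum_biased_mul_separatingLoss_nonpos (s s' : Fin K → Bool) :
    ∑ a, (biased η h0 h1 s).1 a * separatingLoss s s' a ≤ 0 := by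
  rw [Fintype.sum_prod_type]
  refine Finset.sum_nonpos fun k _ => ?_
  have hK : (0 : ℝ) < K := Nat.cast_pos.2 (NeZero.pos K)
  simp only [Fintype.sum_bool, biased, separatingLoss]
  cases s k <;> cases s' k <;> simp <;> field_simp <;> linarith

/-- Only the pairs where s and s' differ carry loss, and its sign follows s': such a pair
contributes η/K under s' and -η/K under s. -/
lemma sum_biased_mul_separatingLoss (s s' : Fin K → Bool) :
    ∑ a, (biased η h0 h1 s').1 a * separatingLoss s s' a = 2 * η * hammingDist s s' / (2 * K) := by
  have hK : (K : ℝ) ≠ 0 := Nat.cast_ne_zero.2 (NeZero.ne K)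
  rw [Fintype.sum_prod_type, hammingDist, Finset.card_filter, Nat.cast_sum, Finset.mul_sum,
    Finset.sum_div]
  refine Finset.sum_congr rfl fun k _ => ?_
  simp only [Fintype.sum_bool, biased, separatingLoss]
  cases s k <;> cases s' k <;> simp <;> field_simp <;> ring

end biased

/-- A set of Boolean vectors of diameter less than `K / 8` is exponentially small. -/
lemma card_le_of_hammingDist_lt {K : ℕ} (A : Finset (Fin K → Bool))
    (hA : ∀ s ∈ A, ∀ s' ∈ A, 8 * hammingDist s s' < K) : (A.card : ℝ) ≤ (18 / 11) ^ K := by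
  rcases A.eq_empty_or_nonempty with rfl | ⟨s, hs⟩
  · simp only [Finset.card_empty, Nat.cast_zero]
    positivity
  have hterm : ∀ s' ∈ A, (1 : ℝ) ≤ (12 / 11) ^ K * (1 / 2) ^ hammingDist s s' := by
    intro s' hs'
    calc (1 : ℝ) = (2 * (1 / 2)) ^ hammingDist s s' := by norm_num
      _ = 2 ^ hammingDist s s' * (1 / 2) ^ hammingDist s s' := mul_pow _ _ _
      -- A Chernoff-type bound with weight 1/2 per disagreement: 2 ≤ (12/11)⁸ converts a distance
      -- below K/8 into the factor (12/11)^K, and (12/11)·(3/2) = 18/11.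
      _ ≤ ((12 / 11) ^ 8) ^ hammingDist s s' * (1 / 2) ^ hammingDist s s' := by
        refine mul_le_mul_of_nonneg_right (pow_le_pow_left₀ (by norm_num) (by norm_num) _)
          (by positivity)
      _ ≤ _ := by
        rw [← pow_mul]
        exact mul_le_mul_of_nonneg_right
          (pow_le_pow_right₀ (by norm_num) (hA s hs s' hs').le) (by positivity)
  have hsum : ∑ s' : Fin K → Bool, (1 / 2 : ℝ) ^ hammingDist s s' = (3 / 2) ^ K := by
    have h1 : ∀ s' : Fin K → Bool, (1 / 2 : ℝ) ^ hammingDist s s' =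
        ∏ k, if s k ≠ s' k then (1 / 2 : ℝ) else 1 := by
      intro s'
      rw [Finset.prod_ite]
      simp [hammingDist]
    have h2 := Finset.prod_univ_sum (fun _ : Fin K => (Finset.univ : Finset Bool))
      (fun k b => if s k ≠ b then (1 / 2 : ℝ) else 1)
    rw [Fintype.piFinset_univ] at h2
    simp only [h1]
    rw [← h2]
    have h3 : ∀ k, ∑ b : Bool, (if s k ≠ b then (1 / 2 : ℝ) else 1) = 3 / 2 := by
      intro k
      cases s k <;> norm_num
    simp only [h3, Finset.prod_const, Finset.card_univ, Fintype.card_fin]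
  calc (A.card : ℝ) = ∑ s' ∈ A, 1 := by simp
    _ ≤ ∑ s' ∈ A, (12 / 11) ^ K * (1 / 2) ^ hammingDist s s' := Finset.sum_le_sum hterm
    _ ≤ ∑ s', (12 / 11) ^ K * (1 / 2) ^ hammingDist s s' :=
        Finset.sum_le_sum_of_subset_of_nonneg (Finset.subset_univ A)
          fun _ _ _ => by positivity
    _ = (18 / 11) ^ K := by
        rw [← Finset.mul_sum, hsum, ← mul_pow]
        norm_num

/-! ### The lower bounds -/

lemma violates_biased {n K : ℕ} [NeZero K] (e : Fin K × Bool ↪ Fin n) {j k : Fin n} (hjk : j ≠ k)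
    {η : ℝ} (h0 : 0 ≤ η) (h1 : η ≤ 1) {s s' : Fin K → Bool} (hs : K ≤ 8 * hammingDist s s') :
    Violates (η / 16) (spread e (biased η h0 h1 s), pureStrategy j)
      (spread e (biased η h0 h1 s'), pureStrategy j) := by
  have hK : (0 : ℝ) < K := Nat.cast_pos.2 (NeZero.pos K)
  have hd : (K : ℝ) ≤ 8 * hammingDist s s' := by exact_mod_cast hs
  have hmul : ∀ v : stdSimplex ℝ (Fin K × Bool),
      ∑ i, (spread e v).1 i * Function.extend e (separatingLoss s s') 0 i =
        ∑ a, v.1 a * separatingLoss s s' a := fun v => by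
    refine (sum_extend_mul e v.1 _).trans ?_
    simp only [e.injective.extend_apply]
  refine violates_of_loss_vector hjk (b := Function.extend e (separatingLoss s s') 0)
    (fun i => ?_) ?_ ?_
  · by_cases hi : ∃ a, e a = i
    · obtain ⟨a, rfl⟩ := hi
      rw [e.injective.extend_apply]
      exact separatingLoss_mem s s' a
    · rw [Function.extend_apply' _ _ _ hi]
      simp
  · rw [hmul]
    exact sum_biased_mul_separatingLoss_nonpos h0 h1 s s'
  · rw [hmul, sum_biased_mul_separatingLoss, le_div_iff₀ (by positivity)]
    nlinarith [mul_le_mul_of_nonneg_left hd h0]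

section

variable {n : ℕ} {M : Type} [PseudoEMetricSpace M] {target : Profile n → Set M} {π ε δ : ℝ}

/-- When rare actions are the bottleneck, the hard instance is a pure profile. -/
lemma exists_le_expectedTime_of_support (hn : 2 ≤ n) (hπ0 : 0 < π) (hπ : π ≤ 1 / 2)
    (hε : ε ≤ 1 / 2) (hδ0 : 0 < δ) (hδ : δ ≤ 1 / 2)
    (hsep : ∀ p q, Violates (2 * ε) p q → Separated ε (target p) (target q)) :
    ∃ p ∈ instanceClass n π, ∀ alg : Algorithm n M, alg.IsCorrect target (instanceClass n π) ε δ →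
      ENNReal.ofReal (Real.log (1 / δ) / (640 * Real.log (1 / (1 - π)))) ≤
        alg.expectedTime p := by
  let i : Fin n := ⟨0, by omega⟩
  let k : Fin n := ⟨1, by omega⟩
  have hik : i ≠ k := by simp [i, k]
  have h0 : 0 ≤ 1 - π := by linarith
  have h1 : 1 - π ≤ 1 := by linarith
  have hpos : 0 < 1 - π := by linarith
  set z := twoPoint hik (1 - π) h0 h1
  have hzi : z.1 i = 1 - π := twoPoint_apply_fst hik h0 h1
  have hzk : z.1 k = π := (twoPoint_apply_snd hik h0 h1).trans (by ring)
  have hpure := le_pureStrategy_of_pos i (π := π) (by linarith)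
  have hmix : ∀ l, 0 < z.1 l → π ≤ z.1 l :=
    le_twoPoint_of_pos hik h0 h1 (by linarith) (by linarith)
  have hexp : Real.exp (Real.log (1 / (1 - π))) = 1 / (1 - π) := Real.exp_log (by positivity)
  have hii : (pureStrategy i).1 i = 1 := by simp [pureStrategy, basisVec]
  have hz0 : z.1 i ≠ 0 := by rw [hzi]; exact hpos.ne'
  have hD : 0 < Real.log (1 / (1 - π)) := Real.log_pos (by rw [lt_div_iff₀ hpos]; linarith)
  refine ⟨(pureStrategy i, pureStrategy i), mem_instanceClass hpure hpure, fun alg halg => ?_⟩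
  refine alg.le_expectedTime_of_separated halg hδ0 hδ hD
    (q₁ := (z, pureStrategy i)) (q₂ := (pureStrategy i, z))
    (mem_instanceClass hpure hpure) (mem_instanceClass hmix hpure) (mem_instanceClass hpure hmix)
    ?_ ?_ ?_ ?_ ?_
  · refine chiSqBound_pureStrategy_snd i (pureStrategy_eq_zero hz0) ?_
    rw [sum_pureStrategy_sq_div, hexp, hzi]
  · refine ⟨fun _ h => h, pureStrategy_eq_zero hz0, ?_⟩
    rw [sum_pureStrategy_sq_div, sum_pureStrategy_sq_div, hexp, hzi, hii]
    simp
  · exact hsep _ _ (violates_of_support_fst hik _ (by rw [hzk]; exact hπ0) (by linarith))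
  · exact hsep _ _ (violates_of_support_snd hik _ (by rw [hzk]; exact hπ0) (by linarith))
  · exact hsep _ _ (violates_of_support_snd hik _ (by rw [hzk]; exact hπ0) (by linarith))

/-- When accuracy is the bottleneck, the hard instance mixes two actions evenly. -/
lemma exists_le_expectedTime_of_accuracy (hn : 2 ≤ n) (hπε : π ≤ 1 / 2 - 2 * ε)
    (hε0 : 0 < ε) (hε : ε < 1 / 384) (hδ0 : 0 < δ) (hδ : δ ≤ 1 / 2)
    (hsep : ∀ p q, Violates (2 * ε) p q → Separated ε (target p) (target q)) :
    ∃ p ∈ instanceClass n π, ∀ alg : Algorithm n M, alg.IsCorrect target (instanceClass n π) ε δ →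
      ENNReal.ofReal (Real.log (1 / δ) / (640 * (32 * ε ^ 2))) ≤ alg.expectedTime p := by
  let i : Fin n := ⟨0, by omega⟩
  let k : Fin n := ⟨1, by omega⟩
  have hik : i ≠ k := by simp [i, k]
  have hpure := le_pureStrategy_of_pos i (π := π) (by linarith)
  have hclass : ∀ (a : ℝ) (h0 : 0 ≤ a) (h1 : a ≤ 1), π ≤ a → π ≤ 1 - a →
      (twoPoint hik a h0 h1, pureStrategy i) ∈ instanceClass n π := fun a h0 h1 ha ha' =>
    mem_instanceClass (le_twoPoint_of_pos hik h0 h1 ha ha') hpure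
  have hviol : ∀ (a b c : ℝ) (ha0 : 0 ≤ a) (ha1 : a ≤ 1) (hb0 : 0 ≤ b) (hb1 : b ≤ 1),
      |c| ≤ 1 → c * (2 * a - 1) ≤ 0 → 4 * ε ≤ c * (2 * b - 1) →
      Separated ε (target (twoPoint hik a ha0 ha1, pureStrategy i))
        (target (twoPoint hik b hb0 hb1, pureStrategy i)) := by
    intro a b c ha0 ha1 hb0 hb1 hc ha hb
    have hki : k ≠ i := hik.symm
    refine hsep _ _ (violates_of_loss_vector hik
      (b := fun l => if l = i then c else -c) (fun l => ?_) ?_ ?_)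
    · obtain ⟨h1, h2⟩ := abs_le.1 hc
      split_ifs <;> constructor <;> linarith
    · rw [sum_twoPoint_mul, if_pos rfl, if_neg hki]
      linarith
    · rw [sum_twoPoint_mul, if_pos rfl, if_neg hki]
      linarith
  have hchi : ∀ (b : ℝ) (hb0 : 0 ≤ b) (hb1 : b ≤ 1) (_ : 0 < b) (_ : 0 < 1 - b),
      b * (1 - b) = 1 / 4 - 4 * ε ^ 2 →
      ChiSqBound (twoPoint hik (1 / 2) (by norm_num) (by norm_num), pureStrategy i)
        (twoPoint hik b hb0 hb1, pureStrategy i) (32 * ε ^ 2) := by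
    intro b hb0 hb1 hb hb' hprod
    refine chiSqBound_pureStrategy_snd i ?_ ?_
    · exact spread_eq_zero_of_spread_eq_zero _ _ _ (by
        rintro (_ | _)
        · exact hb'.ne'
        · exact hb.ne')
    -- With b = 1/2 ± 2ε the second moment is 1/(1 - 16ε²) ≤ 1 + 32ε², because 16ε² ≤ 1/2.
    · have h1 : ∑ l, (twoPoint hik (1 / 2) (by norm_num) (by norm_num)).1 l ^ 2 /
          (twoPoint hik b hb0 hb1).1 l = 1 / (4 * (b * (1 - b))) := by
        refine (sum_extend_sq_div_extend _ _ _).trans ?_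
        simp only [Fintype.sum_bool, cond_true, cond_false]
        field_simp
        ring
      have hε2 : ε ^ 2 ≤ 1 / 32 := by nlinarith
      rw [h1, hprod, div_le_iff₀ (by nlinarith)]
      have h2 := Real.add_one_le_exp (32 * ε ^ 2)
      have h3 : 0 ≤ 4 * (1 / 4 - 4 * ε ^ 2) := by linarith
      nlinarith [mul_le_mul_of_nonneg_right h2 h3, sq_nonneg ε]
  refine ⟨(twoPoint hik (1 / 2) (by norm_num) (by norm_num), pureStrategy i),
    hclass _ _ _ (by linarith) (by linarith), fun alg halg => ?_⟩
  refine alg.le_expectedTime_of_separated halg hδ0 hδ (by positivity)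
    (q₁ := (twoPoint hik (1 / 2 + 2 * ε) (by linarith) (by linarith), pureStrategy i))
    (q₂ := (twoPoint hik (1 / 2 - 2 * ε) (by linarith) (by linarith), pureStrategy i))
    (hclass _ _ _ (by linarith) (by linarith)) (hclass _ _ _ (by linarith) (by linarith))
    (hclass _ _ _ (by linarith) (by linarith)) ?_ ?_ ?_ ?_ ?_
  · exact hchi _ _ _ (by linarith) (by linarith) (by ring)
  · exact hchi _ _ _ (by linarith) (by linarith) (by ring)
  · exact hviol _ _ 1 _ _ _ _ (by norm_num) (by linarith) (by linarith)
  · exact hviol _ _ (-1) _ _ _ _ (by norm_num) (by linarith) (by linarith)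
  · exact hviol _ _ (-1) _ _ _ _ (by norm_num) (by linarith) (by linarith)

/-- The larger of the two terms is at least half their sum, and which one is larger depends only on
π and ε. The instance is therefore chosen before the algorithm. -/
lemma exists_le_expectedTime_confidence (hn : 2 ≤ n) (hπ0 : 0 < π) (hπε : π ≤ 1 / 2 - 2 * ε)
    (hε0 : 0 < ε) (hε : ε < 1 / 384) (hδ0 : 0 < δ) (hδ : δ ≤ 1 / 2)
    (hsep : ∀ p q, Violates (2 * ε) p q → Separated ε (target p) (target q)) :
    ∃ p ∈ instanceClass n π, ∀ alg : Algorithm n M, alg.IsCorrect target (instanceClass n π) ε δ →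
      ENNReal.ofReal ((Real.log (1 / δ) / Real.log (1 / (1 - π)) + Real.log (1 / δ) / ε ^ 2) /
        40960) ≤ alg.expectedTime p := by
  have hL : 0 ≤ Real.log (1 / δ) := Real.log_nonneg (by rw [le_div_iff₀ hδ0]; linarith)
  have hD : 0 < Real.log (1 / (1 - π)) :=
    Real.log_pos (by rw [lt_div_iff₀ (by linarith)]; linarith)
  have hε2 : 0 < ε ^ 2 := by positivity
  rcases le_or_gt (Real.log (1 / (1 - π))) (ε ^ 2) with h | h
  · obtain ⟨p, hp, hE⟩ := exists_le_expectedTime_of_support (M := M) hn hπ0 (by linarith)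
      (by linarith) hδ0 hδ hsep
    refine ⟨p, hp, fun alg halg => (ENNReal.ofReal_le_ofReal ?_).trans (hE alg halg)⟩
    have h1 := div_le_div_of_nonneg_left hL hD h
    have h2 : 0 ≤ Real.log (1 / δ) / Real.log (1 / (1 - π)) := by positivity
    rw [mul_comm (640 : ℝ), ← div_div]
    linarith
  · obtain ⟨p, hp, hE⟩ := exists_le_expectedTime_of_accuracy (M := M) hn hπε hε0 hε hδ0 hδ hsep
    refine ⟨p, hp, fun alg halg => (ENNReal.ofReal_le_ofReal ?_).trans (hE alg halg)⟩
    have h1 := div_le_div_of_nonneg_left hL hε2 h.le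
    have h2 : Real.log (1 / δ) / (640 * (32 * ε ^ 2)) = Real.log (1 / δ) / ε ^ 2 / 20480 := by
      field_simp
      ring
    rw [h2]
    linarith

lemma exists_le_expectedTime_dimension (hn : 132 ≤ n) (hπn : π ≤ 1 / n)
    (hε0 : 0 < ε) (hε : ε < 1 / 384) (hδ0 : 0 < δ) (hδ : δ ≤ 1 / 2)
    (hsep : ∀ p q, Violates (2 * ε) p q → Separated ε (target p) (target q))
    (alg : Algorithm n M) (halg : alg.IsCorrect target (instanceClass n π) ε δ) :
    ∃ p ∈ instanceClass n π, ENNReal.ofReal (n / ε ^ 2 / 360448) ≤ alg.expectedTime p := by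
  -- The 2K actions in use are at most half of all n, so even after the downward bias each keeps
  -- probability at least 1/n ≥ π.
  obtain ⟨K, hK33, hKn, hnK⟩ : ∃ K : ℕ, 33 ≤ K ∧ 4 * K ≤ n ∧ n ≤ 8 * K :=
    ⟨n / 4, by omega, by omega, by omega⟩
  have : NeZero K := ⟨by omega⟩
  have hK0 : (33 : ℝ) ≤ K := by exact_mod_cast hK33
  have hKn' : 4 * (K : ℝ) ≤ n := by exact_mod_cast hKn
  have hnK' : (n : ℝ) ≤ 8 * K := by exact_mod_cast hnK
  obtain ⟨e⟩ : Nonempty (Fin K × Bool ↪ Fin n) :=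
    Function.Embedding.nonempty_of_card_le (by simp; omega)
  let i : Fin n := ⟨0, by omega⟩
  let k : Fin n := ⟨1, by omega⟩
  have hik : i ≠ k := by simp [i, k]
  have hn1 : 1 / (n : ℝ) ≤ 1 := by rw [div_le_one (by linarith)]; linarith
  -- The bias 32ε is chosen so that a Hamming distance of K/8 produces a gap of 32ε/8 = 4ε.
  have h0 : 0 ≤ 32 * ε := by positivity
  have h1 : 32 * ε ≤ 1 := by linarith
  set q : (Fin K → Bool) → Profile n := fun s => (spread e (biased (32 * ε) h0 h1 s), pureStrategy i)
    with hqdef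
  set q₀ : Profile n := (spread e (biased 0 le_rfl zero_le_one fun _ => true), pureStrategy i)
  have hq : ∀ s, q s ∈ instanceClass n π := by
    intro s
    refine mem_instanceClass (le_spread_of_pos e _ fun a _ => ?_)
      (le_pureStrategy_of_pos i (hπn.trans hn1))
    refine hπn.trans (le_trans ?_ (le_biased_apply h0 h1 s a))
    rw [div_le_div_iff₀ (by linarith) (by linarith)]
    nlinarith
  have hchi : ∀ s, ChiSqBound (q s) q₀ (1024 * ε ^ 2) := by
    intro s
    refine chiSqBound_pureStrategy_snd i (spread_eq_zero_of_spread_eq_zero e _ _ fun a => ?_) ?_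
    · rw [biased_zero_apply]
      positivity
    · refine (sum_extend_sq_div_extend e _ _).trans_le ?_
      rw [sum_biased_sq_div]
      have := Real.add_one_le_exp (1024 * ε ^ 2)
      linarith
  have hN : ∀ (O : Set M) (A : Finset (Fin K → Bool)),
      (∀ s ∈ A, Metric.hausdorffEDist (target (q s)) O < ENNReal.ofReal ε) →
        (A.card : ℝ) ≤ (18 / 11) ^ K := by
    intro O A hA
    refine card_le_of_hammingDist_lt A fun s hs s' hs' => ?_
    by_contra! hcon
    have hv := violates_biased e hik h0 h1 hcon
    rw [show 32 * ε / 16 = 2 * ε by ring] at hv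
    exact absurd ((hsep _ _ hv).le_of_lt (hA s' hs')) (not_le.2 (hA s hs))
  -- The exponential factor is e^(K/11). Since (18/11)·e^(2/11) ≤ 2, a second factor e^(K/11) is to
  -- spare, and it exceeds 16 once K ≥ 33; this is where n ≥ 132 comes from.
  have hlt : (18 / 11 : ℝ) ^ K * Real.exp (4 * (1024 * ε ^ 2) * (K / (44 * (1024 * ε ^ 2)))) <
      Fintype.card (Fin K → Bool) / 16 := by
    have hexp : 4 * (1024 * ε ^ 2) * (K / (44 * (1024 * ε ^ 2))) = K * (1 / 11) := by
      field_simp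
      norm_num
    have he1 : Real.exp (1 / 11) ^ 2 ≤ 11 / 9 := by
      rw [← Real.exp_nat_mul]
      have h2 := Real.one_sub_le_exp_neg (2 / 11)
      rw [Real.exp_neg] at h2
      have h3 := (le_inv_comm₀ (by norm_num) (Real.exp_pos _)).1 h2
      norm_num at h3 ⊢
      exact h3
    have he2 : 16 < Real.exp (1 / 11) ^ K := by
      calc (16 : ℝ) < 2.7 ^ 3 := by norm_num
        _ ≤ Real.exp 1 ^ 3 :=
          pow_le_pow_left₀ (by norm_num) (by linarith [Real.exp_one_gt_d9]) 3
        _ = Real.exp (1 / 11) ^ 33 := by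
          rw [← Real.exp_nat_mul, ← Real.exp_nat_mul]
          norm_num
        _ ≤ _ := pow_le_pow_right₀ (Real.one_le_exp (by norm_num)) hK33
    have hpos : 0 < Real.exp (1 / 11) ^ K := by positivity
    rw [hexp, Real.exp_nat_mul, Fintype.card_pi_const, Fintype.card_bool]
    have h4 : (18 / 11 : ℝ) ^ K * (Real.exp (1 / 11) ^ K * Real.exp (1 / 11) ^ K) ≤ 2 ^ K := by
      rw [← mul_pow, ← mul_pow]
      exact pow_le_pow_left₀ (by positivity) (by nlinarith) K
    have h5 : (0 : ℝ) < (18 / 11) ^ K * Real.exp (1 / 11) ^ K := by positivity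
    push_cast
    nlinarith
  obtain ⟨s, hs⟩ := alg.exists_le_expectedTime_of_card_le halg hδ0 hδ (by positivity)
    (by positivity) q q₀ hq hchi hN hlt
  refine ⟨q s, hq s, (ENNReal.ofReal_le_ofReal ?_).trans hs⟩
  rw [div_div, div_le_div_iff₀ (by positivity) (by positivity)]
  nlinarith [mul_le_mul_of_nonneg_right hnK' (by positivity : 0 ≤ ε ^ 2)]

/-- Both lower bounds for a learning problem in which violated equilibrium conditions separate the
targets. -/
lemma lowerBounds (hn : 2 ≤ n) (hπ0 : 0 < π) (hπn : π ≤ 1 / n)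
    (hπε : π ≤ 1 / 2 - 2 * ε) (hε0 : 0 < ε) (hε : ε < 1 / 384) (hδ0 : 0 < δ) (hδ : δ ≤ 1 / 2)
    (hsep : ∀ p q, Violates (2 * ε) p q → Separated ε (target p) (target q)) :
    (∃ p ∈ instanceClass n π, ∀ alg : Algorithm n M,
      alg.IsCorrect target (instanceClass n π) ε δ →
        ENNReal.ofReal (1 / 10 ^ 7 * (Real.log (1 / δ) / Real.log (1 / (1 - π)) +
          Real.log (1 / δ) / ε ^ 2)) ≤ alg.expectedTime p) ∧
    ∀ alg : Algorithm n M, alg.IsCorrect target (instanceClass n π) ε δ →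
      ∃ p ∈ instanceClass n π,
        ENNReal.ofReal (1 / 10 ^ 7 * (Real.log (1 / δ) / Real.log (1 / (1 - π)) +
          (n + Real.log (1 / δ)) / ε ^ 2)) ≤ alg.expectedTime p := by
  have hL : Real.log 2 ≤ Real.log (1 / δ) :=
    Real.log_le_log (by norm_num) (by rw [le_div_iff₀ hδ0]; linarith)
  have hlog2 := Real.log_two_gt_d9
  have hD : 0 < Real.log (1 / (1 - π)) :=
    Real.log_pos (by rw [lt_div_iff₀ (by linarith)]; linarith)
  obtain ⟨p, hp, hE⟩ := exists_le_expectedTime_confidence (M := M) hn hπ0 hπε hε0 hε hδ0 hδ hsep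
  set L := Real.log (1 / δ)
  have hL0 : 0 < L := by linarith
  have ha : 0 ≤ L / Real.log (1 / (1 - π)) := by positivity
  have hb : 0 ≤ L / ε ^ 2 := by positivity
  have hd : 0 ≤ n / ε ^ 2 := by positivity
  refine ⟨⟨p, hp, fun alg halg => (ENNReal.ofReal_le_ofReal ?_).trans (hE alg halg)⟩,
    fun alg halg => ?_⟩
  · linarith
  rw [add_div]
  -- Either the confidence terms dominate the dimension term up to the factor 198, and 199 · 40960 ≤
  -- 10⁷, or the dimension bound absorbs them.
  by_cases hsmall : (n : ℝ) / ε ^ 2 ≤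
      198 * (L / Real.log (1 / (1 - π)) + L / ε ^ 2)
  · refine ⟨p, hp, (ENNReal.ofReal_le_ofReal ?_).trans (hE alg halg)⟩
    linarith
  · have hn132 : 132 ≤ n := by
      by_contra! hlt
      refine hsmall ?_
      -- Small n always falls in the first case, as 132 ≤ 198·log 2 ≤ 198·L.
      have h1 : (n : ℝ) ≤ 198 * L := by
        have : (n : ℝ) ≤ 132 := by exact_mod_cast hlt.le
        linarith
      have h2 := div_le_div_of_nonneg_right h1 (sq_nonneg ε)
      rw [mul_div_assoc] at h2
      linarith
    obtain ⟨p', hp', hE'⟩ :=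
      exists_le_expectedTime_dimension hn132 hπn hε0 hε hδ0 hδ hsep alg halg
    refine ⟨p', hp', (ENNReal.ofReal_le_ofReal ?_).trans hE'⟩
    linarith

end

end InverseGame

theorem mainTheorem2 :
    ∃ c : ℝ, 0 < c ∧
      ∀ (n : ℕ) (πmin ε δ : ℝ),
        2 ≤ n → 0 < πmin → πmin ≤ 1 / (n : ℝ) → πmin ≤ 1 / 2 - 2 * ε →
        0 < ε → ε < 1 / 384 → 0 < δ → δ ≤ 1 / 2 →
        -- general-sum games
        ((∃ p ∈ InverseGame.instanceClass n πmin,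
            ∀ alg : InverseGame.Algorithm n (InverseGame.Payoff n × InverseGame.Payoff n),
              alg.IsCorrect (InverseGame.feasibleGeneralSum 0)
                (InverseGame.instanceClass n πmin) ε δ →
              ENNReal.ofReal (c * (Real.log (1 / δ) / Real.log (1 / (1 - πmin))
                + Real.log (1 / δ) / ε ^ 2)) ≤ alg.expectedTime p) ∧
          (∀ alg : InverseGame.Algorithm n (InverseGame.Payoff n × InverseGame.Payoff n),
              alg.IsCorrect (InverseGame.feasibleGeneralSum 0)
                (InverseGame.instanceClass n πmin) ε δ →
              ∃ p ∈ InverseGame.instanceClass n πmin,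
                ENNReal.ofReal (c * (Real.log (1 / δ) / Real.log (1 / (1 - πmin))
                  + ((n : ℝ) + Real.log (1 / δ)) / ε ^ 2)) ≤ alg.expectedTime p)) ∧
        -- zero-sum games
        ((∃ p ∈ InverseGame.instanceClass n πmin,
            ∀ alg : InverseGame.Algorithm n (InverseGame.Payoff n),
              alg.IsCorrect (InverseGame.feasibleZeroSum 0)
                (InverseGame.instanceClass n πmin) ε δ →
              ENNReal.ofReal (c * (Real.log (1 / δ) / Real.log (1 / (1 - πmin))
                + Real.log (1 / δ) / ε ^ 2)) ≤ alg.expectedTime p) ∧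
          (∀ alg : InverseGame.Algorithm n (InverseGame.Payoff n),
              alg.IsCorrect (InverseGame.feasibleZeroSum 0)
                (InverseGame.instanceClass n πmin) ε δ →
              ∃ p ∈ InverseGame.instanceClass n πmin,
                ENNReal.ofReal (c * (Real.log (1 / δ) / Real.log (1 / (1 - πmin))
                  + ((n : ℝ) + Real.log (1 / δ)) / ε ^ 2)) ≤ alg.expectedTime p)) := by
  refine ⟨1 / 10 ^ 7, by norm_num, ?_⟩
  intro n πmin ε δ hn hπ0 hπn hπε hε0 hε hδ0 hδ
  exact ⟨InverseGame.lowerBounds hn hπ0 hπn hπε hε0 hε hδ0 hδ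
      fun _ _ h => h.separated_generalSum hε0.le,
    InverseGame.lowerBounds hn hπ0 hπn hπε hε0 hε hδ0 hδ
      fun _ _ h => h.separated_zeroSum hε0.le⟩
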